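/- Let $n\ge 1$ agents $1,\dots,n$ and a finite set $M$ of $m\ge 0$ indivisible chores be given, where agent $i$ values chore $c$ at $v_i(c)$ and bundles additively, $v_i(S)=\sum_{c\in S}v_i(c)$. The instance is \emph{bivalued} if there are real numbers $x<y<0$ such that $v_i(c)\in\{x,y\}$ for all $i$ and $c$. An allocation $A=(A_1,\dots,A_n)$ is a partition of $M$ into $n$ (possibly empty) bundles. It is \emph{Pareto optimal} if there is no allocation $B$ with $v_i(B_i)\ge v_i(A_i)$ for all $i$ and with strict inequality for some $i$. It is \emph{envy-free up to $k$ dubious chores} (DEF-$k$) if there are a multiset $D$ of at most $k$ copies of chores of $M$ and a partition $(A_1^D,\dots,A_n^D)$ of the multiset $D$ such that $v_i(A_i)\ge v_i(A_h)+v_i(A_h^D)$ for all agents $i\ne h$ (the copies given to an agent do not cost that agent anything, but the other agents take them for real chores). \textbf{Theorem.} Every bivalued instance with real values has an allocation that is both DEF-$(n-1)$ and Pareto optimal. Moreover, such an allocation can be computed in polynomial time: there are one program and one polynomial $P$ such that, for every bivalued instance with integer values $v_i(c)$, the program, given $n$, $m$ and the values, halts and outputs a DEF-$(n-1)$ and Pareto-optimal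 allocation after at most $P(L)$ steps, where $L$ is the size of the instance, namely $n+m$ plus the total length of the values written in binary with a sign. (Programs are those of a random access machine over the integers that has addition, subtraction, comparison and indirect addressing at unit cost.) -/

import Mathlib

/-! ### Chore division instances, allocations, fairness and efficiency

An instance with agents `Fin n` and chores `Fin m` is given by the values `v i c` of single chores;
valuations of bundles are additive. An allocation is the function that sends every chore to the
agent receiving it, so the bundles are disjoint, cover all chores, and may be empty. -/

/-- The bundle `A_i` of agent `i` under the allocation `A`. -/
def bundle {n m : ℕ} (A : Fin m → Fin n) (i : Fin n) : Finset (Fin m) :=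
  Finset.univ.filter (fun c => A c = i)

/-- The additive value `v_i(S)` of a set of chores. -/
noncomputable def bundleValue {n m : ℕ} (v : Fin n → Fin m → ℝ) (i : Fin n)
    (S : Finset (Fin m)) : ℝ :=
  ∑ c ∈ S, v i c

/-- The value, in the eyes of agent `i`, of the bundle of agent `h` in the augmented allocation
`A ⊎ A^D`. Every agent other than `h` takes the dubious copies given to `h` for real chores,
while `h` values them at zero. -/
noncomputable def augmentedValue {n m : ℕ} (v : Fin n → Fin m → ℝ) (A : Fin m → Fin n)
    (AD : Fin n → Multiset (Fin m)) (i h : Fin n) : ℝ :=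
  if h = i then bundleValue v i (bundle A i)
  else bundleValue v i (bundle A h) + ((AD h).map (v i)).sum

/-- `A` is envy-free up to `k` dubious chores. The dubious multiset `D` is recorded by the original
chores of which it contains copies. -/
def IsDEF {n m : ℕ} (v : Fin n → Fin m → ℝ) (A : Fin m → Fin n) (k : ℕ) : Prop :=
  ∃ (D : Multiset (Fin m)) (AD : Fin n → Multiset (Fin m)),
    D.card ≤ k ∧ ∑ i, AD i = D ∧
      ∀ i h : Fin n, augmentedValue v A AD i h ≤ augmentedValue v A AD i i

/-- `A` is Pareto dominated by `B`. -/
def ParetoDominatedBy {n m : ℕ} (v : Fin n → Fin m → ℝ) (A B : Fin m → Fin n) : Prop :=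
  (∀ i, bundleValue v i (bundle A i) ≤ bundleValue v i (bundle B i)) ∧
    ∃ i, bundleValue v i (bundle A i) < bundleValue v i (bundle B i)

/-- `A` is Pareto optimal among all allocations of the chores. -/
def IsParetoOptimal {n m : ℕ} (v : Fin n → Fin m → ℝ) (A : Fin m → Fin n) : Prop :=
  ¬ ∃ B : Fin m → Fin n, ParetoDominatedBy v A B

/-- All agents value all chores at one of two common negative numbers `x < y < 0`. -/
def IsBivalued {n m : ℕ} (v : Fin n → Fin m → ℝ) : Prop :=
  ∃ x y : ℝ, x < y ∧ y < 0 ∧ ∀ i c, v i c = x ∨ v i c = y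

/-! ### Programs and running time

Random access machines over the integers, programmed by while-programs, with the unit-cost
measure. The only arithmetic operations are addition and subtraction. One unit of time therefore
lengthens the largest number in memory by at most a bit or so, and a number of steps polynomial in
the bit length of the input is the same as polynomial time on Turing machines. -/

/-- A memory state: integer registers, and tables of integers with two indices. -/
structure MemState where
  reg : ℕ → ℤ
  tab : ℕ → ℕ → ℕ → ℤ

/-- Integer expressions. `read a e f` is the entry of table `a` at the position given by the values
of `e` and `f` (indirect addressing; a negative index is read as `0`). -/
inductive Expr where
  | const (z : ℤ)
  | var (x : ℕ)
  | read (a : ℕ) (e f : Expr)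
  | add (e f : Expr)
  | sub (e f : Expr)

def Expr.eval (s : MemState) : Expr → ℤ
  | .const z => z
  | .var x => s.reg x
  | .read a e f => s.tab a (e.eval s).toNat (f.eval s).toNat
  | .add e f => e.eval s + f.eval s
  | .sub e f => e.eval s - f.eval s

/-- The time for evaluating an expression: one unit for each of its nodes. -/
def Expr.cost : Expr → ℕ
  | .const _ => 1
  | .var _ => 1
  | .read _ e f => e.cost + f.cost + 1
  | .add e f => e.cost + f.cost + 1
  | .sub e f => e.cost + f.cost + 1

/-- Boolean conditions. -/
inductive Cond where
  | lt (e f : Expr)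
  | eq (e f : Expr)
  | not (b : Cond)
  | and (b c : Cond)
  | or (b c : Cond)

def Cond.holds (s : MemState) : Cond → Prop
  | .lt e f => e.eval s < f.eval s
  | .eq e f => e.eval s = f.eval s
  | .not b => ¬ b.holds s
  | .and b c => b.holds s ∧ c.holds s
  | .or b c => b.holds s ∨ c.holds s

/-- The time for evaluating a condition: one unit for each of its nodes. -/
def Cond.cost : Cond → ℕ
  | .lt e f => e.cost + f.cost + 1
  | .eq e f => e.cost + f.cost + 1
  | .not b => b.cost + 1
  | .and b c => b.cost + c.cost + 1
  | .or b c => b.cost + c.cost + 1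

/-- While-programs. -/
inductive Prog where
  | skip
  | assign (x : ℕ) (e : Expr)
  | write (a : ℕ) (e f g : Expr)
  | seq (p q : Prog)
  | ite (b : Cond) (p q : Prog)
  | while (b : Cond) (p : Prog)

/-- The state after storing `z` in register `x`. -/
def MemState.setReg (s : MemState) (x : ℕ) (z : ℤ) : MemState :=
  { s with reg := fun y => if y = x then z else s.reg y }

/-- The state after storing `z` at position `(i, j)` of table `a`. -/
def MemState.setTab (s : MemState) (a i j : ℕ) (z : ℤ) : MemState :=
  { s with tab := fun b k l => if b = a ∧ k = i ∧ l = j then z else s.tab b k l }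

/-- `Runs p s t s'`: started in state `s`, the program `p` halts in state `s'` after exactly `t`
units of time. -/
inductive Runs : Prog → MemState → ℕ → MemState → Prop where
  | skip (s : MemState) : Runs .skip s 1 s
  | assign (s : MemState) (x : ℕ) (e : Expr) :
      Runs (.assign x e) s (e.cost + 1) (s.setReg x (e.eval s))
  | write (s : MemState) (a : ℕ) (e f g : Expr) :
      Runs (.write a e f g) s (e.cost + f.cost + g.cost + 1)
        (s.setTab a (e.eval s).toNat (f.eval s).toNat (g.eval s))
  | seq {p q : Prog} {s s' s'' : MemState} {t t' : ℕ} :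
      Runs p s t s' → Runs q s' t' s'' → Runs (.seq p q) s (t + t') s''
  | iteTrue {b : Cond} {p q : Prog} {s s' : MemState} {t : ℕ} :
      b.holds s → Runs p s t s' → Runs (.ite b p q) s (b.cost + t + 1) s'
  | iteFalse {b : Cond} {p q : Prog} {s s' : MemState} {t : ℕ} :
      ¬ b.holds s → Runs q s t s' → Runs (.ite b p q) s (b.cost + t + 1) s'
  | whileFalse {b : Cond} {p : Prog} {s : MemState} :
      ¬ b.holds s → Runs (.while b p) s (b.cost + 1) s
  | whileTrue {b : Cond} {p : Prog} {s s' s'' : MemState} {t t' : ℕ} :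
      b.holds s → Runs p s t s' → Runs (.while b p) s' t' s'' →
        Runs (.while b p) s (b.cost + t + t' + 1) s''

/-- The input state for an integer instance: register `0` holds `n`, register `1` holds `m`,
table `0` holds the values `v i c`, and everything else is `0`. -/
def inputState {n m : ℕ} (v : Fin n → Fin m → ℤ) : MemState where
  reg := fun x => if x = 0 then n else if x = 1 then m else 0
  tab := fun a i c => if h : a = 0 ∧ i < n ∧ c < m then v ⟨i, h.2.1⟩ ⟨c, h.2.2⟩ else 0

/-- The size of an integer instance: its agents, its chores, and its values written in binary,
each with a sign. -/
def inputSize {n m : ℕ} (v : Fin n → Fin m → ℤ) : ℕ :=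
  n + m + ∑ i, ∑ c, ((v i c).natAbs.size + 1)

/-- The state `s` holds the allocation `A` as output: entry `(c, 0)` of table `1` is the agent that
receives chore `c`. -/
def OutputsAllocation {n m : ℕ} (s : MemState) (A : Fin m → Fin n) : Prop :=
  ∀ c : Fin m, s.tab 1 c 0 = ((A c : ℕ) : ℤ)

/-!
# Bivalued chores: fairness up to `n - 1` dubious chores together with Pareto optimality

Write `a ≤ b` for the two costs; a chore is easy for the agents whose cost is `a`. The theorem follows
from market prices. Suppose that the chores have prices such that every agent holds only chores that
minimize its cost per unit of price. Then the allocation is Pareto optimal, and if moreover the prices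
of any two bundles differ by at most the price of a single chore `c₀`, then copies of `c₀` for all
agents but one of maximal price remove all envy (`isDEF_and_isParetoOptimal_of_prices`). So it is
enough to find prices and an integral equilibrium that is balanced in this weak sense.

The prices have the following form. Every chore that is easy for somebody gets an owner who finds it
easy, and every agent gets a label, such that labels drop by at most one along a chore that its owner
could pass on to another agent who finds it easy, and such that the number of chores of an agent is
its label divided by `n + 1`, up to rounding (`IsLabelling`, `exists_labelling`). Such labels are found
as in an auction: an agent whose label is too small passes on a chore to an agent of smaller label,
or raises its label if it cannot. A threshold `θ` divides the agents into upper agents, with labels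
at least `θ`, and lower agents. If no label equals `θ - 1`, then no lower agent finds a chore of an
upper agent easy. Chores of lower agents have price `a` and stay where they are; all other chores
have price `b`, and may be given to lower agents, for whom they are difficult. Those that are
difficult for everybody must be given away in any case. These gifts are made greedily: from upper
agents of maximal load to lower agents of minimal load, where the load is the price of the bundle.

Some threshold and some number `g` of gifts of upper agents lead to loads that differ by at most `b`
(`false_of_forall_unbalanced`). To see this, follow pairs `(θ, g)` for which upper loads differ by at
most `b` and a lower agent that has received a gift exceeds nobody by more than `b` (`IsTight`). If
the loads are still unbalanced, then either an upper agent exceeds a lower one by more than `b`, and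
`g + 1` gifts are again tight, or a lower agent without gifts has too large a load. In this case the
threshold can be lowered so that the lower agents with the most chores, up to one chore, become
upper agents, for the same `g`. As `θ` never increases and `g` never decreases, this comes to an end.
A suitable threshold exists because there are `n + 1` candidates and only `n` labels (`exists_gap`).
All these steps compare greedy fillings with the same or almost the same number of gifts.

The program computes owners and labels, and then simply tries all thresholds and all numbers of
gifts. The number of rounds of the label computation is bounded by a potential (`potential`); all
other loops have obvious bounds. Programs are verified through the predicate `Ends`, which
combines termination, a time bound and a postcondition.
-/

namespace ChoreDivision

open Finset

/-! ### Configurations: the numbers behind transfers of chores -/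

section Configurations

/-- The agents whose label is at least the threshold `θ`. -/
def upper (n : ℕ) (D : ℕ → ℕ) (θ : ℕ) : Finset ℕ := (range n).filter (fun i => θ ≤ D i)

/-- The agents whose label is below the threshold `θ`. -/
def lower (n : ℕ) (D : ℕ → ℕ) (θ : ℕ) : Finset ℕ := (range n).filter (fun i => D i < θ)

theorem mem_upper {n : ℕ} {D : ℕ → ℕ} {θ i : ℕ} : i ∈ upper n D θ ↔ i < n ∧ θ ≤ D i := by
  simp [upper]

theorem mem_lower {n : ℕ} {D : ℕ → ℕ} {θ i : ℕ} : i ∈ lower n D θ ↔ i < n ∧ D i < θ := by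
  simp [lower]

variable {R : Type*} [CommRing R]

/-- The price of the bundle of agent `i`, if it contains `x i` chores of price `b` and, for a lower
agent, moreover its `e i` chores of price `a`. -/
def configLoad (e D : ℕ → ℕ) (a b : R) (θ : ℕ) (x : ℕ → ℕ) (i : ℕ) : R :=
  if θ ≤ D i then b * x i else a * e i + b * x i

theorem configLoad_upper {n : ℕ} {e D : ℕ → ℕ} {a b : R} {θ : ℕ} {x : ℕ → ℕ} {i : ℕ}
    (h : i ∈ upper n D θ) : configLoad e D a b θ x i = b * x i :=
  if_pos (mem_upper.1 h).2

theorem configLoad_lower {n : ℕ} {e D : ℕ → ℕ} {a b : R} {θ : ℕ} {x : ℕ → ℕ} {i : ℕ}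
    (h : i ∈ lower n D θ) : configLoad e D a b θ x i = a * e i + b * x i :=
  if_neg (not_le.2 (mem_lower.1 h).2)

variable [LinearOrder R] [IsStrictOrderedRing R]

/-- The numerical shadow of an allocation for the threshold `θ`. Every upper agent `i` keeps `x i` of
its `e i` chores; the `g` chores they lose, and the `u` chores that are difficult for everybody, are
held by lower agents, `x i` of them by agent `i`. Chores are taken only from upper agents of maximal
load and given only to lower agents of minimal load. -/
structure IsConfig (n : ℕ) (e D : ℕ → ℕ) (u : ℕ) (a b : R) (θ g : ℕ) (x : ℕ → ℕ) : Prop where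
  le : ∀ i ∈ upper n D θ, x i ≤ e i
  sum_upper : ∑ i ∈ upper n D θ, x i + g = ∑ i ∈ upper n D θ, e i
  sum_lower : ∑ i ∈ lower n D θ, x i = u + g
  bal_upper : ∀ i ∈ upper n D θ, x i < e i → ∀ j ∈ upper n D θ, x j ≤ x i + 1
  bal_lower : ∀ k ∈ lower n D θ, 0 < x k → ∀ l ∈ lower n D θ,
    a * e k + b * x k ≤ a * e l + b * x l + b

theorem upper_or_lower {n : ℕ} (D : ℕ → ℕ) (θ : ℕ) {i : ℕ} (h : i < n) :
    i ∈ upper n D θ ∨ i ∈ lower n D θ := by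
  rw [mem_upper, mem_lower]; omega

theorem natCast_lt_of_mul_lt {b : R} (hb : 0 < b) {x y : ℕ} (h : b * x < b * y) : x < y := by
  exact_mod_cast lt_of_mul_lt_mul_left h hb.le

theorem mul_natCast_le {b : R} (hb : 0 < b) {x y : ℕ} (h : x ≤ y) : b * (x : R) ≤ b * y :=
  mul_le_mul_of_nonneg_left (by exact_mod_cast h) hb.le

/-- Greedy filling is monotone: an agent whose load stays within one chore of the water level `Λ`
does not hold more chores than in a filling in which its load exceeds `Λ`. -/
theorem le_of_water_level {a b Λ : R} (hb : 0 < b) {e x y : ℕ}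
    (hx : 0 < x → a * e + b * x ≤ Λ + b) (hy : Λ < a * e + b * y) : x ≤ y := by
  by_contra! h
  have h1 := mul_natCast_le hb (Nat.succ_le_of_lt h)
  have h2 := hx (by omega)
  push_cast at h1
  linarith

/-- The strict form of `le_of_water_level`. -/
theorem lt_of_water_level {a b Λ : R} (hb : 0 < b) {e x y : ℕ}
    (hx : 0 < x → a * e + b * x ≤ Λ + b) (hy0 : 0 < y) (hy : Λ + b < a * e + b * y) : x < y := by
  by_contra! h
  have h1 := mul_natCast_le hb h
  have h2 := hx (by omega)
  linarith

/-- The invariant under which thresholds and transfers are explored: the upper loads differ by at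
most one chore, and a lower agent that holds a chore of price `b` exceeds nobody's load by more
than `b`. -/
structure IsTight (n : ℕ) (e D : ℕ → ℕ) (u : ℕ) (a b : R) (θ g : ℕ) (x : ℕ → ℕ) : Prop
    extends IsConfig n e D u a b θ g x where
  upper_spread : ∀ i ∈ upper n D θ, ∀ j ∈ upper n D θ, x i ≤ x j + 1
  lower_spread : ∀ k ∈ lower n D θ, 0 < x k → ∀ j < n,
    configLoad e D a b θ x k ≤ configLoad e D a b θ x j + b

variable {n : ℕ} {e D : ℕ → ℕ} {u : ℕ} {a b : R} {θ g : ℕ} {x x' : ℕ → ℕ}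

/-- Tightness survives one more transfer if some upper load exceeds some lower load by more than
`b`. -/
theorem IsTight.transfer (hb : 0 < b) (hx : IsTight n e D u a b θ g x) {h q : ℕ}
    (hh : h ∈ upper n D θ) (hq : q ∈ lower n D θ)
    (hhq : configLoad e D a b θ x q + b < configLoad e D a b θ x h)
    (hx' : IsConfig n e D u a b θ (g + 1) x') : IsTight n e D u a b θ (g + 1) x' := by
  -- it is enough to look at an upper agent of maximal and a lower agent of minimal load
  obtain ⟨h, hh, hq, hmax, hhq⟩ : ∃ h' ∈ upper n D θ, q ∈ lower n D θ ∧
      (∀ i ∈ upper n D θ, x i ≤ x h') ∧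
      configLoad e D a b θ x q + b < configLoad e D a b θ x h' := by
    obtain ⟨h', h1, h2⟩ := exists_max_image (upper n D θ) x ⟨h, hh⟩
    refine ⟨h', h1, hq, h2, hhq.trans_le ?_⟩
    rw [configLoad_upper hh, configLoad_upper h1]
    exact mul_natCast_le hb (h2 h hh)
  obtain ⟨q, hq, hmin, hhq⟩ : ∃ q' ∈ lower n D θ,
      (∀ i ∈ lower n D θ, a * e q' + b * x q' ≤ a * e i + b * x i) ∧
      a * e q' + b * x q' + b < b * x h := by
    obtain ⟨q', h1, h2⟩ := exists_min_image (lower n D θ) (fun i => a * e i + b * x i) ⟨q, hq⟩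
    refine ⟨q', h1, h2, ?_⟩
    have := h2 q hq
    rw [configLoad_upper hh, configLoad_lower hq] at hhq
    linarith
  have hsum : ∑ i ∈ upper n D θ, x' i + 1 = ∑ i ∈ upper n D θ, x i := by
    have h1 := hx.sum_upper
    have h2 := hx'.sum_upper
    omega
  have hle : ∀ i ∈ upper n D θ, x' i ≤ x h := by
    by_contra! hcon
    obtain ⟨j, hj, hjh⟩ := hcon
    have : ∑ i ∈ upper n D θ, x i ≤ ∑ i ∈ upper n D θ, x' i := by
      refine sum_le_sum fun i hi => ?_
      rcases (hx'.le i hi).lt_or_eq with h1 | h1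
      · have := hx'.bal_upper i hi h1 j hj
        have := hmax i hi
        omega
      · rw [h1]; exact hx.le i hi
    omega
  have hge : ∀ j ∈ upper n D θ, x h ≤ x' j + 1 := by
    by_contra! hcon
    obtain ⟨j, hj, hjh⟩ := hcon
    have hxj := hx.upper_spread h hh j hj
    have hej := hx.le j hj
    have hbal : ∀ i ∈ upper n D θ, x' i ≤ x' j + 1 := hx'.bal_upper j hj (by omega)
    have : ∑ i ∈ upper n D θ, (x' i + if i = j then 1 else 0) < ∑ i ∈ upper n D θ, x i := by
      refine sum_lt_sum (fun i hi => ?_) ⟨h, hh, ?_⟩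
      · have h1 := hbal i hi
        have h2 := hx.upper_spread h hh i hi
        split_ifs with hij
        · subst hij; omega
        · omega
      · have h1 := hbal h hh
        split_ifs with hij
        · subst hij; omega
        · omega
    rw [sum_add_distrib, sum_ite_eq' (upper n D θ) j, if_pos hj] at this
    omega
  have hfill : ∀ k ∈ lower n D θ, 0 < x' k →
      a * e k + b * x' k ≤ (a * e q + b * x q) + b := by
    by_contra! hcon
    obtain ⟨k, hk, hk0, hkq⟩ := hcon
    have hlev : ∀ i ∈ lower n D θ, a * e q + b * x q < a * e i + b * x' i := by
      intro i hi
      have := hx'.bal_lower k hk hk0 i hi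
      linarith
    have : ∑ i ∈ lower n D θ, (x i + if i = q then 1 else 0) < ∑ i ∈ lower n D θ, x' i := by
      have hq1 : x q < x' q := natCast_lt_of_mul_lt hb (by linarith [hlev q hq])
      refine sum_lt_sum (fun i hi => ?_) ⟨k, hk, ?_⟩
      · split_ifs with hiq
        · subst hiq; omega
        · exact le_of_water_level hb (fun h0 => hx.bal_lower i hi h0 q hq) (hlev i hi)
      · split_ifs with hiq
        · subst hiq
          refine natCast_lt_of_mul_lt hb ?_
          push_cast
          linarith
        · exact lt_of_water_level hb (fun h0 => hx.bal_lower k hk h0 q hq) hk0 hkq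
    rw [sum_add_distrib, sum_ite_eq' (lower n D θ) q, if_pos hq, hx.sum_lower, hx'.sum_lower] at this
    omega
  refine ⟨hx', fun i hi j hj => (hle i hi).trans (hge j hj), fun k hk hk0 j hj => ?_⟩
  rw [configLoad_lower hk]
  rcases upper_or_lower D θ hj with hj | hj
  · rw [configLoad_upper hj]
    have h1 := hfill k hk hk0
    have h2 := mul_natCast_le hb (hge j hj)
    push_cast at h2
    linarith
  · rw [configLoad_lower hj]
    exact hx'.bal_lower k hk hk0 j hj

/-- Among the thresholds `θ` with `(τ - 1) * (n + 1) < θ ≤ τ * (n + 1)` there is one such that no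
label equals `θ - 1`, since there are more thresholds than agents. -/
theorem exists_gap (n : ℕ) (D : ℕ → ℕ) {τ : ℕ} (hτ : 0 < τ) :
    ∃ θ, (n + 1) * (τ - 1) < θ ∧ θ ≤ (n + 1) * τ ∧ ∀ j < n, D j + 1 ≠ θ := by
  have hlt : ((range n).image D).card < (Ico ((n + 1) * (τ - 1)) ((n + 1) * τ)).card := by
    refine (card_image_le).trans_lt ?_
    rw [Nat.card_Ico, card_range, ← Nat.mul_sub, Nat.sub_sub_self hτ]
    omega
  obtain ⟨w, hw, hwD⟩ := exists_mem_notMem_of_card_lt_card hlt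
  rw [mem_Ico] at hw
  refine ⟨w + 1, by omega, by omega, fun j hj h => hwD ?_⟩
  exact mem_image.2 ⟨j, mem_range.2 hj, by omega⟩

/-- Tightness survives lowering the threshold to the level `τ` of the largest number of chores owned
by a lower agent, if the load of such an agent exceeds the minimal load by more than `b`, and no
upper load exceeds a lower load by more than `b`. -/
theorem IsTight.lower_threshold (ha : 0 < a) (hab : a ≤ b)
    (hD : ∀ i < n, (n + 1) * e i ≤ D i ∧ D i ≤ (n + 1) * (e i + 1))
    (hx : IsTight n e D u a b θ g x) {i q : ℕ} (hi : i ∈ lower n D θ)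
    (hi0 : 0 < e i) (himax : ∀ k ∈ lower n D θ, e k ≤ e i) (hq : q < n)
    (hqmin : ∀ j < n, configLoad e D a b θ x q ≤ configLoad e D a b θ x j)
    (hiq : configLoad e D a b θ x q + b < a * e i)
    (hul : ∀ j ∈ upper n D θ, ∀ k ∈ lower n D θ,
      configLoad e D a b θ x j ≤ configLoad e D a b θ x k + b)
    {θ' : ℕ} (hθ1 : (n + 1) * (e i - 1) < θ') (hθ2 : θ' ≤ (n + 1) * e i) :
    θ' < θ ∧ (lower n D θ').Nonempty ∧ upper n D θ ⊆ upper n D θ' ∧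
      (IsConfig n e D u a b θ' g x' → IsTight n e D u a b θ' g x') := by
  have hb : 0 < b := ha.trans_le hab
  set Λ := configLoad e D a b θ x q with hΛ
  have hΛ0 : 0 ≤ Λ := by
    rw [hΛ, configLoad]
    split_ifs <;> positivity
  have hin := (mem_lower.1 hi).1
  have hiθ := (mem_lower.1 hi).2
  have hDi := hD i hin
  have hlt : θ' < θ := by omega
  have habn : ∀ t : ℕ, a * (t : R) ≤ b * t := fun t =>
    mul_le_mul_of_nonneg_right hab (by positivity)
  have hsub : upper n D θ ⊆ upper n D θ' := by
    intro j hj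
    rw [mem_upper] at hj ⊢
    exact ⟨hj.1, by omega⟩
  have hsubl : lower n D θ' ⊆ lower n D θ := by
    intro j hj
    rw [mem_lower] at hj ⊢
    exact ⟨hj.1, by omega⟩
  -- how the numbers of owned chores relate to the three groups of agents
  have heold : ∀ j ∈ upper n D θ, e i ≤ e j := by
    intro j hj
    rw [mem_upper] at hj
    by_contra! hcon
    have h1 := (hD j hj.1).2
    have h2 : (n + 1) * (e j + 1) ≤ (n + 1) * e i := Nat.mul_le_mul_left _ hcon
    omega
  have henew : ∀ j ∈ upper n D θ', e i ≤ e j + 1 := by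
    intro j hj
    rw [mem_upper] at hj
    by_contra! hcon
    have h1 := (hD j hj.1).2
    have h2 : (n + 1) * (e j + 1) ≤ (n + 1) * (e i - 1) := Nat.mul_le_mul_left _ (by omega)
    omega
  have hmemlow : ∀ k ∈ lower n D θ, a * (e k : R) + b < a * e i → k ∈ lower n D θ' := by
    intro k hk hke
    rw [mem_lower] at hk ⊢
    refine ⟨hk.1, ?_⟩
    have h1 : e k + 1 < e i := by
      refine natCast_lt_of_mul_lt ha ?_
      push_cast
      linarith
    have h2 : (n + 1) * (e k + 1) ≤ (n + 1) * (e i - 1) := Nat.mul_le_mul_left _ (by omega)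
    have h3 := (hD k hk.1).2
    omega
  have hladen : ∀ k ∈ lower n D θ, 0 < x k → a * e k + b * x k ≤ Λ + b := by
    intro k hk hk0
    have := hx.lower_spread k hk hk0 q hq
    rwa [configLoad_lower hk] at this
  have hladenlow : ∀ k ∈ lower n D θ, 0 < x k → k ∈ lower n D θ' := by
    intro k hk hk0
    refine hmemlow k hk ?_
    have h1 := hladen k hk hk0
    have h2 := mul_natCast_le hb (show 1 ≤ x k from hk0)
    push_cast at h2
    linarith
  have hxupper : ∀ j ∈ upper n D θ, x j < e i := by
    intro j hj
    refine natCast_lt_of_mul_lt hb (lt_of_lt_of_le ?_ (habn _))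
    refine lt_of_le_of_lt ?_ hiq
    rcases upper_or_lower D θ hq with hq' | hq'
    · rw [hΛ, configLoad_upper hq']
      have := mul_natCast_le hb (hx.upper_spread j hj q hq')
      push_cast at this
      linarith
    · rw [← configLoad_upper (e := e) (a := a) hj]
      exact hul j hj q hq'
  have hΛupper : ∀ j ∈ upper n D θ, Λ ≤ b * x j := by
    intro j hj
    rw [← configLoad_upper (e := e) (a := a) hj]
    exact hqmin j (mem_upper.1 hj).1
  have hne : (lower n D θ').Nonempty := by
    rcases upper_or_lower D θ hq with hq' | hq'
    · -- agent `q` has lost a chore, so some lower agent has received one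
      have h1 : x q < e q := (hxupper q hq').trans_le (heold q hq')
      have h2 : ∑ i ∈ upper n D θ, x i < ∑ i ∈ upper n D θ, e i := sum_lt_sum hx.le ⟨q, hq', h1⟩
      have h3 : ∑ i ∈ lower n D θ, x i ≠ 0 := by
        have := hx.sum_upper
        have := hx.sum_lower
        omega
      obtain ⟨k, hk, hk0⟩ := exists_ne_zero_of_sum_ne_zero h3
      exact ⟨k, hladenlow k hk (Nat.pos_of_ne_zero hk0)⟩
    · refine ⟨q, hmemlow q hq' ?_⟩
      rw [hΛ, configLoad_lower hq'] at hiq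
      have : 0 ≤ b * (x q : R) := by positivity
      linarith
  refine ⟨hlt, hne, hsub, fun hx' => ?_⟩
  -- `y` extends the old configuration to the new upper agents, which keep all their chores
  -- both configurations have the same sum over the new upper agents
  set y : ℕ → ℕ := fun j => if θ ≤ D j then x j else e j with hy
  have hysum : ∑ j ∈ upper n D θ', y j = ∑ j ∈ upper n D θ', x' j := by
    have h1 := sum_sdiff (f := y) hsub
    have h2 := sum_sdiff (f := e) hsub
    have h3 : ∑ j ∈ upper n D θ, y j = ∑ j ∈ upper n D θ, x j :=
      sum_congr rfl fun j hj => if_pos (mem_upper.1 hj).2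
    have h4 : ∑ j ∈ upper n D θ' \ upper n D θ, y j = ∑ j ∈ upper n D θ' \ upper n D θ, e j := by
      refine sum_congr rfl fun j hj => if_neg ?_
      rw [mem_sdiff, mem_upper, mem_upper] at hj
      tauto
    have h5 := hx.sum_upper
    have h6 := hx'.sum_upper
    omega
  -- upper agents that owned more than `e i` chores keep at most `e i`
  have hle : ∀ j ∈ upper n D θ', x' j ≤ e i := by
    by_contra! hcon
    obtain ⟨j, hj, hji⟩ := hcon
    have hstay : ∀ k ∈ upper n D θ', x' k < e k → e i ≤ x' k := by
      intro k hk hke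
      have := hx'.bal_upper k hk hke j hj
      omega
    refine hysum.not_lt (sum_lt_sum (fun k hk => ?_) ⟨j, hj, ?_⟩)
    · rw [hy]
      dsimp only
      have h1 := hstay k hk
      have h2 := hx'.le k hk
      split_ifs with hkθ
      · have hk' : k ∈ upper n D θ := mem_upper.2 ⟨(mem_upper.1 hk).1, hkθ⟩
        have := hxupper k hk'
        have := heold k hk'
        omega
      · have := himax k (mem_lower.2 ⟨(mem_upper.1 hk).1, by omega⟩)
        omega
    · rw [hy]
      dsimp only
      split_ifs with hkθ
      · exact (hxupper j (mem_upper.2 ⟨(mem_upper.1 hj).1, hkθ⟩)).trans hji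
      · have := himax j (mem_lower.2 ⟨(mem_upper.1 hj).1, by omega⟩)
        have := hx'.le j hj
        omega
  -- an upper agent that has lost a chore is not below the old minimal load
  have hge : ∀ j ∈ upper n D θ', Λ ≤ b * x' j ∨ e j = x' j := by
    by_contra! hcon
    obtain ⟨j, hj, hjΛ, hje⟩ := hcon
    have hje' : x' j < e j := lt_of_le_of_ne (hx'.le j hj) (Ne.symm hje)
    have hold : ∀ k ∈ upper n D θ, x' j < x k := fun k hk =>
      natCast_lt_of_mul_lt hb (hjΛ.trans_le (hΛupper k hk))
    refine hysum.not_gt (sum_lt_sum (fun k hk => ?_) ⟨j, hj, ?_⟩)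
    · rw [hy]
      dsimp only
      split_ifs with hkθ
      · have h1 := hold k (mem_upper.2 ⟨(mem_upper.1 hk).1, hkθ⟩)
        have h2 := hx'.bal_upper j hj hje' k hk
        omega
      · exact hx'.le k hk
    · rw [hy]
      dsimp only
      split_ifs with hkθ
      · exact hold j (mem_upper.2 ⟨(mem_upper.1 hj).1, hkθ⟩)
      · exact hje'
  -- the lower agents that have become upper agents had received nothing, so that the fillings of
  -- the remaining lower agents have the same sum
  have hfill : ∀ k ∈ lower n D θ', 0 < x' k → a * e k + b * x' k ≤ Λ + b := by
    by_contra! hcon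
    obtain ⟨k, hk, hk0, hkq⟩ := hcon
    have hsum : ∑ j ∈ lower n D θ', x j = ∑ j ∈ lower n D θ', x' j := by
      rw [hx'.sum_lower, ← hx.sum_lower]
      refine sum_subset hsubl fun j hj hj' => ?_
      by_contra h0
      exact hj' (hladenlow j hj (Nat.pos_of_ne_zero h0))
    refine hsum.not_lt (sum_lt_sum (fun j hj => ?_) ⟨k, hk, ?_⟩)
    · have := hx'.bal_lower k hk hk0 j hj
      exact le_of_water_level hb (hladen j (hsubl hj)) (by linarith)
    · exact lt_of_water_level hb (hladen k (hsubl hk)) hk0 hkq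
  refine ⟨hx', fun j hj k hk => ?_, fun k hk hk0 j hj => ?_⟩
  · rcases (hx'.le k hk).lt_or_eq with h1 | h1
    · exact hx'.bal_upper k hk h1 j hj
    · have := hle j hj
      have := henew k hk
      omega
  · rw [configLoad_lower hk]
    rcases upper_or_lower D θ' hj with hj | hj
    · rw [configLoad_upper hj]
      have h1 := hfill k hk hk0
      rcases hge j hj with h2 | h2
      · linarith
      · have h3 := mul_natCast_le hb (henew j hj)
        have h4 := habn (e i)
        rw [← h2]
        push_cast at h3
        linarith
    · rw [configLoad_lower hj]
      exact hx'.bal_lower k hk hk0 j hj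

/-- If every admissible pair of a threshold and a number of transfers is represented by a
configuration, then not all of these configurations have loads that differ by more than `b`.
Otherwise every tight pair leads to another tight pair with a lower threshold or with more transfers,
which cannot go on forever. -/
theorem false_of_forall_unbalanced (hn : 0 < n) (ha : 0 < a) (hab : a ≤ b)
    (hD : ∀ i < n, (n + 1) * e i ≤ D i ∧ D i ≤ (n + 1) * (e i + 1))
    (hpos : 0 < u ∨ ∃ i < n, 0 < e i) {Θ : ℕ} (hΘ : ∀ i < n, D i + 1 < Θ)
    (H : ∀ θ ≤ Θ, (∀ j < n, D j + 1 ≠ θ) → (0 < u ∨ ∃ i < n, θ ≤ D i ∧ 0 < e i) →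
      ∀ g ≤ ∑ i ∈ upper n D θ, e i, ((lower n D θ).Nonempty ∨ u = 0 ∧ g = 0) →
        ∃ x, IsConfig n e D u a b θ g x ∧
          ∃ p < n, ∃ q < n, configLoad e D a b θ x q + b < configLoad e D a b θ x p) :
    False := by
  have hb : 0 < b := ha.trans_le hab
  set S := ∑ i ∈ range n, e i with hS
  have hupS : ∀ θ, ∑ i ∈ upper n D θ, e i ≤ S := fun θ =>
    sum_le_sum_of_subset (filter_subset _ _)
  have key : ∀ N θ g, θ ≤ Θ → θ + (S - g) = N → (lower n D θ).Nonempty → (∀ j < n, D j + 1 ≠ θ) →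
      (0 < u ∨ ∃ i < n, θ ≤ D i ∧ 0 < e i) → g ≤ ∑ i ∈ upper n D θ, e i →
      (∀ x, IsConfig n e D u a b θ g x → IsTight n e D u a b θ g x) → False := by
    intro N
    induction N using Nat.strong_induction_on with
    | _ N ih =>
    intro θ g hθ hN hne hgap hpr hg hall
    obtain ⟨x, hx, p, hp, p', hp', hpp'⟩ := H θ hθ hgap hpr g hg (Or.inl hne)
    replace hx := hall x hx
    have hgS := hg.trans (hupS θ)
    by_cases hul : ∃ h ∈ upper n D θ, ∃ k ∈ lower n D θ,
        configLoad e D a b θ x k + b < configLoad e D a b θ x h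
    · obtain ⟨h, hh, k, hk, hhk⟩ := hul
      have hlt : g < ∑ i ∈ upper n D θ, e i := by
        have hxh : 0 < x h := by
          by_contra! h0
          have h0' : x h = 0 := by omega
          rw [configLoad_upper hh, configLoad_lower hk, h0'] at hhk
          have : 0 ≤ a * (e k : R) + b * x k := by positivity
          push_cast at hhk
          linarith
        have := single_le_sum (f := x) (fun i _ => Nat.zero_le _) hh
        have := hx.sum_upper
        omega
      have hltS := hlt.trans_le (hupS θ)
      exact ih _ (by omega) θ (g + 1) hθ rfl hne hgap hpr hlt
        fun x' hx' => hx.transfer hb hh hk hhk hx'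
    · push Not at hul
      obtain ⟨q, hq, hqmin⟩ := exists_min_image (range n) (configLoad e D a b θ x)
        ⟨0, mem_range.2 hn⟩
      simp only [mem_range] at hq hqmin
      have hqp : configLoad e D a b θ x q + b < configLoad e D a b θ x p := by
        have := hqmin p' hp'
        linarith
      have hpl : p ∈ lower n D θ := by
        refine (upper_or_lower D θ hp).resolve_left fun hpu => ?_
        rcases upper_or_lower D θ hq with hq' | hq'
        · rw [configLoad_upper hpu, configLoad_upper hq'] at hqp
          have := mul_natCast_le hb (hx.upper_spread p hpu q hq')
          push_cast at this
          linarith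
        · exact absurd hqp (not_lt.2 (hul p hpu q hq'))
      have hpx : x p = 0 := by
        by_contra h0
        exact absurd hqp (not_lt.2 (hx.lower_spread p hpl (Nat.pos_of_ne_zero h0) q hq))
      obtain ⟨i, hi, himax⟩ := exists_max_image (lower n D θ) e hne
      have hqi : configLoad e D a b θ x q + b < a * e i := by
        refine hqp.trans_le ?_
        rw [configLoad_lower hpl, hpx, Nat.cast_zero, mul_zero, add_zero]
        exact mul_natCast_le ha (himax p hpl)
      have hi0 : 0 < e i := by
        by_contra! h0
        have hpe := himax p hpl
        have hpe0 : e p = 0 := by omega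
        have h1 : 0 ≤ configLoad e D a b θ x q := by
          rw [configLoad]
          split_ifs <;> positivity
        rw [configLoad_lower hpl, hpx, hpe0] at hqp
        push_cast at hqp
        linarith
      obtain ⟨θ', hθ1, hθ2, hgap'⟩ := exists_gap n D hi0
      have hlow : ∀ x', θ' < θ ∧ (lower n D θ').Nonempty ∧ upper n D θ ⊆ upper n D θ' ∧
          (IsConfig n e D u a b θ' g x' → IsTight n e D u a b θ' g x') := fun x' =>
        hx.lower_threshold ha hab hD hi hi0 himax hq hqmin hqi hul hθ1 hθ2
      obtain ⟨hlt, hne', hsub, -⟩ := hlow x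
      have hin := (mem_lower.1 hi).1
      exact ih _ (by omega) θ' g (hlt.le.trans hθ) rfl hne' hgap'
        (Or.inr ⟨i, hin, hθ2.trans (hD i hin).1, hi0⟩) (hg.trans (sum_le_sum_of_subset hsub))
        fun x' => (hlow x').2.2.2
  rcases Nat.eq_zero_or_pos u with hu | hu
  · subst hu
    have hpos' : ∃ i < n, 0 < e i := by simpa using hpos
    -- all chores have price `b`, and all agents are upper agents
    obtain ⟨x, hx, p, hp, q, hq, hpq⟩ := H 0 (Nat.zero_le _) (by simp) (by simpa using hpos') 0
      (Nat.zero_le _) (Or.inr ⟨rfl, rfl⟩)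
    have hall : ∀ i < n, i ∈ upper n D 0 := fun i hi => mem_upper.2 ⟨hi, Nat.zero_le _⟩
    have hxe : ∀ i < n, x i = e i := fun i hi =>
      (sum_eq_sum_iff_of_le hx.le).1 (by simpa using hx.sum_upper) i (hall i hi)
    rw [configLoad_upper (hall p hp), configLoad_upper (hall q hq), hxe p hp, hxe q hq] at hpq
    have hpq' : e q + 1 < e p := by
      refine natCast_lt_of_mul_lt hb ?_
      push_cast
      linarith
    obtain ⟨i, hi, himax⟩ := exists_max_image (range n) e ⟨p, mem_range.2 hp⟩
    rw [mem_range] at hi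
    have hpi := himax p (mem_range.2 hp)
    obtain ⟨θ, h1, h2, hgap⟩ := exists_gap n D (τ := e i) (by omega)
    have hne : (lower n D θ).Nonempty := by
      refine ⟨q, mem_lower.2 ⟨hq, ?_⟩⟩
      have h3 := (hD q hq).2
      have h4 : (n + 1) * (e q + 1) ≤ (n + 1) * (e i - 1) := Nat.mul_le_mul_left _ (by omega)
      omega
    have hθΘ : θ ≤ Θ := by
      have := hΘ i hi
      have := (hD i hi).1
      omega
    have hpr : ∃ i < n, θ ≤ D i ∧ 0 < e i := ⟨i, hi, h2.trans (hD i hi).1, by omega⟩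
    refine key _ θ 0 hθΘ rfl hne hgap (Or.inr hpr) (Nat.zero_le _) fun x hx => ?_
    have hxe : ∀ i ∈ upper n D θ, x i = e i :=
      (sum_eq_sum_iff_of_le hx.le).1 (by simpa using hx.sum_upper)
    refine ⟨hx, fun j hj k hk => ?_, fun k hk hk0 => ?_⟩
    · rw [hxe j hj, hxe k hk]
      rw [mem_upper] at hj hk
      have h3 := himax j (mem_range.2 hj.1)
      by_contra! hcon
      have h4 : (n + 1) * (e k + 1) ≤ (n + 1) * (e i - 1) := Nat.mul_le_mul_left _ (by omega)
      have := (hD k hk.1).2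
      omega
    · have := (sum_eq_zero_iff.1 (hx.sum_lower)) k hk
      omega
  · have hemp : ∀ i, i ∉ upper n D Θ := fun i hi => by
      rw [mem_upper] at hi
      have := hΘ i hi.1
      omega
    have hne : (lower n D Θ).Nonempty :=
      ⟨0, (upper_or_lower D Θ hn).resolve_left (hemp 0)⟩
    have hgap : ∀ j < n, D j + 1 ≠ Θ := fun j hj => (hΘ j hj).ne
    refine key _ Θ 0 le_rfl rfl hne hgap (Or.inl hu) (Nat.zero_le _) fun x hx =>
      ⟨hx, fun i hi => absurd hi (hemp i), fun k hk hk0 j hj => ?_⟩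
    have hj' := (upper_or_lower D Θ hj).resolve_left (hemp j)
    rw [configLoad_lower hk, configLoad_lower hj']
    exact hx.bal_lower k hk hk0 j hj'

end Configurations

/-! ### Labels of agents -/

section Labellings

/-- The number of chores that `A` assigns to `i`. -/
def cnt (m : ℕ) (A : ℕ → ℕ) (i : ℕ) : ℕ := ((range m).filter (fun c => A c = i)).card

/-- The change of a sum over all chores when the chore `c` is reassigned to `k`. -/
theorem sum_range_update {M : Type*} [AddCommMonoid M] {m c : ℕ} (hc : c < m) (A : ℕ → ℕ) (k : ℕ)
    (F : ℕ → ℕ → M) :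
    ∑ d ∈ range m, F d (Function.update A c k d) + F c (A c) =
      ∑ d ∈ range m, F d (A d) + F c k := by
  rw [← add_sum_erase _ _ (mem_range.2 hc), ← add_sum_erase (range m) (fun d => F d (A d))
    (mem_range.2 hc), Function.update_self]
  have : ∑ d ∈ (range m).erase c, F d (Function.update A c k d) =
      ∑ d ∈ (range m).erase c, F d (A d) :=
    sum_congr rfl fun d hd => by rw [Function.update_of_ne (ne_of_mem_erase hd)]
  rw [this]
  abel

theorem cnt_update {m c : ℕ} (hc : c < m) (A : ℕ → ℕ) (k i : ℕ) :
    cnt m (Function.update A c k) i + (if A c = i then 1 else 0) =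
      cnt m A i + (if k = i then 1 else 0) := by
  simp only [cnt, card_filter]
  exact sum_range_update hc A k (fun _ j => if j = i then 1 else 0)

theorem cnt_le (m : ℕ) (A : ℕ → ℕ) (i : ℕ) : cnt m A i ≤ m :=
  (card_filter_le _ _).trans (card_range m).le

/-- An assignment `own` of the chores to agents that find them easy, with labels of the agents. The
chores that no agent finds easy are assigned to dummy agents `n` or above. Along a chore that an agent
could pass on to `j`, labels drop by at most one, and the label of an agent is at most `n + 1` times
the number of its chores, up to the additive constant `n + 1`. The field `bdd` bounds the labels in advance. The
factor `n + 1` makes room for a value that is no label between any two levels. -/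
structure IsLabelling (n m : ℕ) (ez : ℕ → ℕ → Prop) (own D : ℕ → ℕ) : Prop where
  easy : ∀ c < m, own c < n → ez (own c) c
  hard : ∀ c < m, n ≤ own c → ∀ i < n, ¬ ez i c
  valid : ∀ c < m, own c < n → ∀ j < n, ez j c → D (own c) ≤ D j + 1
  le : ∀ i < n, D i ≤ (n + 1) * (cnt m own i + 1)
  bdd : ∀ i < n, D i ≤ (n + 1) * m

/-- The potential that bounds the number of moves and raises. -/
def potential (n m : ℕ) (own D : ℕ → ℕ) : ℕ :=
  ∑ c ∈ range m, (if own c < n then D (own c) else 0) +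
    (m + 1) * ∑ i ∈ range n, ((n + 1) * m - D i)

variable {n m : ℕ} {ez : ℕ → ℕ → Prop} {own D : ℕ → ℕ}

/-- An agent whose label is too small may pass on a chore to an agent of smaller label. -/
theorem IsLabelling.move (h : IsLabelling n m ez own D) {c j : ℕ} (hc : c < m) (hcn : own c < n)
    (hj : j < n) (hez : ez j c) (hlt : D j < D (own c))
    (hover : D (own c) < (n + 1) * cnt m own (own c)) :
    IsLabelling n m ez (Function.update own c j) D ∧
      potential n m (Function.update own c j) D < potential n m own D := by
  have hne : own c ≠ j := fun h => by rw [h] at hlt; exact lt_irrefl _ hlt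
  refine ⟨⟨fun d hd => ?_, fun d hd => ?_, fun d hd => ?_, fun i hi => ?_, h.bdd⟩, ?_⟩
  · rcases eq_or_ne d c with rfl | hdc
    · simpa using fun _ => hez
    · simpa [hdc] using h.easy d hd
  · rcases eq_or_ne d c with rfl | hdc
    · simp only [Function.update_self]; omega
    · simpa [hdc] using h.hard d hd
  · rcases eq_or_ne d c with rfl | hdc
    · simp only [Function.update_self]
      intro _ k hk hkc
      have := h.valid d hd hcn k hk hkc
      omega
    · simpa [hdc] using h.valid d hd
  · have h1 := cnt_update hc own j i
    have h2 := h.le i hi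
    by_cases hi1 : own c = i
    · subst hi1
      rw [if_pos rfl, if_neg (Ne.symm hne)] at h1
      rw [h1]
      exact hover.le
    · rw [if_neg hi1] at h1
      exact h2.trans (Nat.mul_le_mul_left _ (by omega))
  · have := sum_range_update hc own j (fun _ i => if i < n then D i else 0)
    simp only [if_pos hcn, if_pos hj] at this
    unfold potential
    omega

/-- If passing on a chore to an agent of smaller label is impossible, a label that is too small may be
raised. -/
theorem IsLabelling.raise (h : IsLabelling n m ez own D) {i : ℕ} (hi : i < n)
    (hover : D i < (n + 1) * cnt m own i)
    (hstuck : ∀ c < m, own c = i → ∀ j < n, ez j c → D i ≤ D j) :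
    IsLabelling n m ez own (Function.update D i (D i + 1)) ∧
      potential n m own (Function.update D i (D i + 1)) < potential n m own D := by
  have hm : D i < (n + 1) * m := hover.trans_le (Nat.mul_le_mul_left _ (cnt_le _ _ _))
  refine ⟨⟨h.easy, h.hard, fun c hc hcn j hj hez => ?_, fun k hk => ?_, fun k hk => ?_⟩,
    ?_⟩
  · have h1 := h.valid c hc hcn j hj hez
    have h2 := hstuck c hc
    have h3 : D j ≤ Function.update D i (D i + 1) j := by
      rcases eq_or_ne j i with rfl | hji
      · simp
      · simp [hji]
    rcases eq_or_ne (own c) i with hci | hci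
    · have := h2 hci j hj hez
      rw [hci, Function.update_self]
      omega
    · rw [Function.update_of_ne hci]
      omega
  · rcases eq_or_ne k i with rfl | hki
    · rw [Function.update_self, mul_add]
      omega
    · rw [Function.update_of_ne hki]
      exact h.le k hk
  · rcases eq_or_ne k i with rfl | hki
    · rw [Function.update_self]
      omega
    · rw [Function.update_of_ne hki]
      exact h.bdd k hk
  · have h1 := sum_range_update hi D (D i + 1) (fun _ d => (n + 1) * m - d)
    have h2 : ∑ c ∈ range m, (if own c < n then Function.update D i (D i + 1) (own c) else 0) ≤
        ∑ c ∈ range m, (if own c < n then D (own c) else 0) + m := by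
      calc _ ≤ ∑ c ∈ range m, ((if own c < n then D (own c) else 0) + 1) := by
            refine sum_le_sum fun c _ => ?_
            rcases eq_or_ne (own c) i with hci | hci
            · rw [hci, Function.update_self]
              split_ifs
              omega
            · rw [Function.update_of_ne hci]
              omega
        _ = _ := by rw [sum_add_distrib]; simp
    have h3 : ∑ d ∈ range n, ((n + 1) * m - Function.update D i (D i + 1) d) + 1 =
        ∑ d ∈ range n, ((n + 1) * m - D d) := by
      omega
    unfold potential
    rw [← h3, mul_add]
    omega

/-- There is a labelling in which the labels are also large enough for the numbers of chores, since
moves and raises decrease the potential. -/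
theorem exists_labelling (n m : ℕ) (ez : ℕ → ℕ → Prop) :
    ∃ own D, IsLabelling n m ez own D ∧ ∀ i < n, (n + 1) * cnt m own i ≤ D i := by
  have key : ∀ N own D, potential n m own D = N → IsLabelling n m ez own D →
      ∃ own D, IsLabelling n m ez own D ∧ ∀ i < n, (n + 1) * cnt m own i ≤ D i := by
    intro N
    induction N using Nat.strong_induction_on with
    | _ N ih =>
    intro own D hN h
    by_cases hall : ∀ i < n, (n + 1) * cnt m own i ≤ D i
    · exact ⟨own, D, h, hall⟩
    push Not at hall
    obtain ⟨i, hi, hover⟩ := hall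
    by_cases hmv : ∃ c < m, own c = i ∧ ∃ j < n, ez j c ∧ D j < D i
    · obtain ⟨c, hc, rfl, j, hj, hez, hlt⟩ := hmv
      obtain ⟨h1, h2⟩ := h.move hc hi hj hez hlt hover
      exact ih _ (hN ▸ h2) _ _ rfl h1
    · push Not at hmv
      obtain ⟨h1, h2⟩ := h.raise hi hover hmv
      exact ih _ (hN ▸ h2) _ _ rfl h1
  classical
  let own : ℕ → ℕ := fun c => if hc : ∃ i < n, ez i c then hc.choose else n
  have hown : ∀ c, own c < n → ez (own c) c := by
    intro c hcn
    by_cases hc : ∃ i < n, ez i c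
    · simp only [own, dif_pos hc]
      exact hc.choose_spec.2
    · simp [own, dif_neg hc] at hcn
  refine key _ own (fun _ => 0) rfl ⟨fun c _ => hown c, fun c _ hcn i hi hez => ?_,
    by simp, by simp, by simp⟩
  · have hc : ∃ i < n, ez i c := ⟨i, hi, hez⟩
    simp only [own, dif_pos hc] at hcn
    exact absurd hc.choose_spec.1 (not_lt.2 hcn)

end Labellings

/-! ### Assignments that arise by transfers -/

section Assignments

/-- A chore is cheap for the threshold `θ` if it is owned by an agent whose label is below `θ`. -/
def Cheap (n : ℕ) (own D : ℕ → ℕ) (θ c : ℕ) : Prop := own c < n ∧ D (own c) < θ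

instance (n : ℕ) (own D : ℕ → ℕ) (θ c : ℕ) : Decidable (Cheap n own D θ c) :=
  inferInstanceAs (Decidable (_ ∧ _))

/-- The market price of a chore: `a` for cheap chores, and `b` for all others. -/
def price {R : Type*} (n : ℕ) (own D : ℕ → ℕ) (a b : R) (θ c : ℕ) : R :=
  if Cheap n own D θ c then a else b

/-- The total price of the bundle of agent `i`. -/
def load {R : Type*} [AddCommMonoid R] (n m : ℕ) (own D : ℕ → ℕ) (a b : R) (θ : ℕ) (A : ℕ → ℕ)
    (i : ℕ) : R :=
  ∑ c ∈ range m, if A c = i then price n own D a b θ c else 0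

/-- The number of chores, among those owned by an agent, that `A` assigns to another agent. -/
def moved (n m : ℕ) (own A : ℕ → ℕ) : ℕ :=
  ((range m).filter (fun c => own c < n ∧ A c ≠ own c)).card

variable {R : Type*} [CommRing R] [LinearOrder R] [IsStrictOrderedRing R]

/-- The partial assignments `A` that arise from `own` by transfers of chores from the dummy agent
`n`, and from upper agents of maximal load, to lower agents of minimal load. -/
structure IsAssignment (n m : ℕ) (own D : ℕ → ℕ) (a b : R) (θ : ℕ) (A : ℕ → ℕ) : Prop where
  cheap : ∀ c < m, Cheap n own D θ c → A c = own c
  kept : ∀ c < m, A c < n → θ ≤ D (A c) → own c = A c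
  unassigned : ∀ c < m, n ≤ A c → own c = A c
  bal_upper : ∀ i ∈ upper n D θ, (∃ c < m, own c = i ∧ A c ≠ i) → ∀ j ∈ upper n D θ,
    load n m own D a b θ A j ≤ load n m own D a b θ A i + b
  bal_lower : ∀ k ∈ lower n D θ, (∃ c < m, A c = k ∧ own c ≠ k) → ∀ l ∈ lower n D θ,
    load n m own D a b θ A k ≤ load n m own D a b θ A l + b

variable {n m : ℕ} {ez : ℕ → ℕ → Prop} {own D : ℕ → ℕ} {a b : R} {θ : ℕ} {A : ℕ → ℕ}

omit [IsStrictOrderedRing R] in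
theorem isAssignment_own : IsAssignment n m own D a b θ own where
  cheap _ _ _ := rfl
  kept _ _ _ _ := rfl
  unassigned _ _ _ := rfl
  bal_upper _ _ h := by obtain ⟨c, -, h1, h2⟩ := h; exact absurd h1 h2
  bal_lower _ _ h := by obtain ⟨c, -, h1, h2⟩ := h; exact absurd h1 h2

omit [LinearOrder R] [IsStrictOrderedRing R] in
theorem load_update {c : ℕ} (hc : c < m) (k i : ℕ) :
    load n m own D a b θ (Function.update A c k) i +
        (if A c = i then price n own D a b θ c else 0) =
      load n m own D a b θ A i + (if k = i then price n own D a b θ c else 0) :=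
  sum_range_update hc A k (fun d j => if j = i then price n own D a b θ d else 0)

/-- Transferring a chore from the dummy agent or from an upper agent of maximal load to a lower
agent of minimal load. -/
theorem IsAssignment.give (hb : 0 < b) (hA : IsAssignment n m own D a b θ A) {c k : ℕ} (hc : c < m)
    (hfrom : n ≤ A c ∨ A c ∈ upper n D θ ∧ ∀ j ∈ upper n D θ,
      load n m own D a b θ A j ≤ load n m own D a b θ A (A c))
    (hk : k ∈ lower n D θ)
    (hmin : ∀ l ∈ lower n D θ, load n m own D a b θ A k ≤ load n m own D a b θ A l) :
    IsAssignment n m own D a b θ (Function.update A c k) := by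
  have hk' := mem_lower.1 hk
  have hown : own c = A c := by
    rcases hfrom with h | ⟨h, -⟩
    · exact hA.unassigned c hc h
    · exact hA.kept c hc (mem_upper.1 h).1 (mem_upper.1 h).2
  have hexp : ¬ Cheap n own D θ c := by
    rintro ⟨h1, h2⟩
    rcases hfrom with h | ⟨h, -⟩
    · omega
    · rw [mem_upper, ← hown] at h
      omega
  have hload := load_update (n := n) (own := own) (D := D) (a := a) (b := b) (θ := θ) (A := A) hc k
  have hprice : price n own D a b θ c = b := if_neg hexp
  simp only [hprice] at hload
  have hlow : ∀ l ∈ lower n D θ, load n m own D a b θ A l ≤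
      load n m own D a b θ (Function.update A c k) l := by
    intro l hl
    have h1 := hload l
    rw [mem_lower] at hl
    rw [if_neg] at h1
    · split_ifs at h1 <;> linarith
    · rintro h2
      rcases hfrom with h | ⟨h, -⟩
      · omega
      · rw [mem_upper] at h
        rw [h2] at h
        omega
  have hup : ∀ i ∈ upper n D θ, load n m own D a b θ (Function.update A c k) i +
      (if A c = i then b else 0) = load n m own D a b θ A i := by
    intro i hi
    rw [hload i, if_neg, add_zero]
    rintro rfl
    rw [mem_upper] at hi
    omega
  refine ⟨fun d hd hdc => ?_, fun d hd => ?_, fun d hd => ?_, fun i hi hex j hj => ?_,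
    fun k' hk' hex l hl => ?_⟩
  · rw [Function.update_of_ne]
    · exact hA.cheap d hd hdc
    · rintro rfl
      exact hexp hdc
  · rcases eq_or_ne d c with rfl | hdc
    · rw [Function.update_self]
      omega
    · rw [Function.update_of_ne hdc]
      exact hA.kept d hd
  · rcases eq_or_ne d c with rfl | hdc
    · rw [Function.update_self]
      omega
    · rw [Function.update_of_ne hdc]
      exact hA.unassigned d hd
  · have h1 := hup i hi
    have h2 := hup j hj
    have h3 : load n m own D a b θ (Function.update A c k) j ≤ load n m own D a b θ A j := by
      split_ifs at h2 <;> linarith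
    by_cases hci : A c = i
    · rw [if_pos hci] at h1
      rcases hfrom with h | ⟨-, h⟩
      · rw [mem_upper] at hi
        omega
      · have := h j hj
        rw [hci] at this
        linarith
    · rw [if_neg hci] at h1
      obtain ⟨d, hd, hdi, hAd⟩ := hex
      have hdc : d ≠ c := by
        rintro rfl
        exact hci (hown ▸ hdi)
      rw [Function.update_of_ne hdc] at hAd
      have := hA.bal_upper i hi ⟨d, hd, hdi, hAd⟩ j hj
      linarith
  · have h1 := hlow l hl
    rcases eq_or_ne k' k with rfl | hkk
    · have h2 := hload k'
      have h3 : (0 : R) ≤ if A c = k' then b else 0 := by split_ifs <;> simp [hb.le]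
      rw [if_pos rfl] at h2
      have := hmin l hl
      linarith
    · obtain ⟨d, hd, hdk, hod⟩ := hex
      have hdc : d ≠ c := by
        rintro rfl
        rw [Function.update_self] at hdk
        exact hkk hdk.symm
      rw [Function.update_of_ne hdc] at hdk
      have h2 := hload k'
      rw [if_neg (Ne.symm hkk)] at h2
      have h3 : (0 : R) ≤ if A c = k' then b else 0 := by split_ifs <;> simp [hb.le]
      have := hA.bal_lower k' hk' ⟨d, hd, hdk, hod⟩ l hl
      linarith

omit [IsStrictOrderedRing R] in
theorem moved_update (hA : IsAssignment n m own D a b θ A) {c k : ℕ} (hc : c < m) (hk : k < n)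
    (hkD : D k < θ) (hfrom : n ≤ A c ∨ A c < n ∧ θ ≤ D (A c)) :
    moved n m own (Function.update A c k) = moved n m own A + if A c < n then 1 else 0 := by
  have h := sum_range_update hc A k (fun d j => if own d < n ∧ j ≠ own d then 1 else 0)
  have hown : own c = A c := by
    rcases hfrom with h | ⟨h, h'⟩
    · exact hA.unassigned c hc h
    · exact hA.kept c hc h h'
  simp only [moved, card_filter]
  rw [hown] at h
  have h1 : (if A c < n ∧ k ≠ A c then 1 else 0) = if A c < n then 1 else 0 := by
    refine if_congr (and_iff_left_of_imp fun h1 h2 => ?_) rfl rfl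
    rw [← h2] at hfrom
    omega
  simpa [h1] using h

theorem sum_card_filter_and (S : Finset ℕ) (m : ℕ) (A : ℕ → ℕ) (P : ℕ → Prop) [DecidablePred P] :
    ∑ i ∈ S, ((range m).filter (fun c => A c = i ∧ P c)).card =
      ∑ c ∈ range m, if A c ∈ S ∧ P c then 1 else 0 := by
  simp only [card_filter]
  rw [sum_comm]
  refine sum_congr rfl fun c _ => ?_
  by_cases hP : P c <;> simp [hP]

/-- The number of chores of price `b` that `A` assigns to agent `i`. -/
def expensive (n m : ℕ) (own D : ℕ → ℕ) (θ : ℕ) (A : ℕ → ℕ) (i : ℕ) : ℕ :=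
  ((range m).filter (fun c => A c = i ∧ ¬ Cheap n own D θ c)).card

/-- Upper agents hold no cheap chores, and lower agents hold precisely those they own. -/
theorem IsAssignment.load_eq (hA : IsAssignment n m own D a b θ A) {i : ℕ} (hi : i < n) :
    load n m own D a b θ A i =
      configLoad (cnt m own) D a b θ (expensive n m own D θ A) i := by
  have h1 : load n m own D a b θ A i =
      a * ((range m).filter (fun c => A c = i ∧ Cheap n own D θ c)).card +
        b * expensive n m own D θ A i := by
    simp only [load, expensive, card_filter, Nat.cast_sum, mul_sum]
    rw [← sum_add_distrib]
    refine sum_congr rfl fun c _ => ?_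
    by_cases h1 : A c = i <;> by_cases h2 : Cheap n own D θ c <;> simp [h1, h2, price]
  rw [h1, configLoad]
  split_ifs with hθ
  · rw [filter_false_of_mem]
    · simp
    · rintro c hc ⟨rfl, h2⟩
      have := hA.cheap c (mem_range.1 hc) h2
      have h3 := h2.2
      rw [← this] at h3
      omega
  · rw [cnt]
    congr 4
    refine filter_congr fun c hc => ⟨fun h => ?_, fun h => ?_⟩
    · rw [← hA.cheap c (mem_range.1 hc) h.2, h.1]
    · have : Cheap n own D θ c := ⟨h ▸ hi, by rw [h]; omega⟩
      exact ⟨(hA.cheap c (mem_range.1 hc) this).trans h, this⟩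

theorem IsAssignment.isConfig (hb : 0 < b) (hA : IsAssignment n m own D a b θ A)
    (htot : ∀ c < m, A c < n) :
    IsConfig n (cnt m own) D ((range m).filter (fun c => n ≤ own c)).card a b θ (moved n m own A)
      (expensive n m own D θ A) where
  le i hi := by
    refine card_le_card fun c hc => ?_
    simp only [mem_filter, mem_range] at hc ⊢
    rw [mem_upper] at hi
    obtain ⟨h1, rfl, -⟩ := hc
    exact ⟨h1, hA.kept c h1 hi.1 hi.2⟩
  sum_upper := by
    have h1 := sum_card_filter_and (upper n D θ) m own (fun _ => True)
    simp only [and_true] at h1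
    simp only [expensive, cnt]
    rw [sum_card_filter_and, h1, moved, card_filter, ← sum_add_distrib]
    refine sum_congr rfl fun c hc => ?_
    rw [mem_range] at hc
    have h2 := hA.cheap c hc
    have h3 := hA.kept c hc
    have h4 := htot c hc
    simp only [Cheap, mem_upper] at *
    grind
  sum_lower := by
    simp only [expensive]
    rw [sum_card_filter_and, moved, card_filter, card_filter, ← sum_add_distrib]
    refine sum_congr rfl fun c hc => ?_
    rw [mem_range] at hc
    have h2 := hA.cheap c hc
    have h3 := hA.kept c hc
    have h4 := htot c hc
    simp only [Cheap, mem_lower] at *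
    grind
  bal_upper i hi hlt j hj := by
    have hex : ∃ c < m, own c = i ∧ A c ≠ i := by
      by_contra! hcon
      refine hlt.not_ge (card_le_card fun c hc => ?_)
      simp only [mem_filter, mem_range] at hc ⊢
      refine ⟨hc.1, hcon c hc.1 hc.2, fun h => ?_⟩
      rw [mem_upper] at hi
      have := h.2
      rw [hc.2] at this
      omega
    have h1 := hA.bal_upper i hi hex j hj
    rw [hA.load_eq (mem_upper.1 hi).1, hA.load_eq (mem_upper.1 hj).1, configLoad_upper hi,
      configLoad_upper hj] at h1
    refine Nat.lt_succ_iff.1 (natCast_lt_of_mul_lt hb ?_)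
    push_cast
    linarith
  bal_lower k hk hk0 l hl := by
    obtain ⟨c, hc⟩ := card_pos.1 hk0
    simp only [mem_filter, mem_range] at hc
    rw [← configLoad_lower hk, ← configLoad_lower hl, ← hA.load_eq (mem_lower.1 hk).1,
      ← hA.load_eq (mem_lower.1 hl).1]
    refine hA.bal_lower k hk ⟨c, hc.1, hc.2.1, fun h => hc.2.2 ?_⟩ l hl
    rw [mem_lower, ← h] at hk
    exact hk

end Assignments

/-! ### Existence of a balanced assignment -/

section Solutions

variable {R : Type*} [CommRing R] [LinearOrder R] [IsStrictOrderedRing R]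

/-- A threshold `θ` and a complete assignment of the chores for it such that some chore has price
`b` and the prices of any two bundles differ by at most `b`. -/
structure IsSolution (n m : ℕ) (own D : ℕ → ℕ) (a b : R) (θ : ℕ) (A : ℕ → ℕ) : Prop
    extends IsAssignment n m own D a b θ A where
  total : ∀ c < m, A c < n
  gap : ∀ j < n, D j + 1 ≠ θ
  priced : ∃ c < m, ¬ Cheap n own D θ c
  balanced : ∀ p < n, ∀ q < n, load n m own D a b θ A p ≤ load n m own D a b θ A q + b

/-- Some assignment that arises by `g` transfers from upper agents has two loads that differ by more
than `b`. -/
abbrev Unbalanced (n m : ℕ) (own D : ℕ → ℕ) (a b : R) (θ g : ℕ) : Prop :=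
  ∃ A, IsAssignment n m own D a b θ A ∧ (∀ c < m, A c < n) ∧ moved n m own A = g ∧
    ∃ p < n, ∃ q < n, load n m own D a b θ A q + b < load n m own D a b θ A p

/-- The threshold `θ` has been tried in vain: each number of transfers that is possible for it leads
to an assignment in which two loads differ by more than `b`. -/
def Exhausted (n m : ℕ) (own D : ℕ → ℕ) (a b : R) (θ : ℕ) : Prop :=
  (∀ j < n, D j + 1 ≠ θ) → (∃ c < m, ¬ Cheap n own D θ c) →
    ∀ g ≤ ∑ i ∈ upper n D θ, cnt m own i,
      ((lower n D θ).Nonempty ∨ (∀ c < m, own c < n) ∧ g = 0) → Unbalanced n m own D a b θ g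

variable {n m : ℕ} {ez : ℕ → ℕ → Prop} {own D : ℕ → ℕ} {a b : R} {θ : ℕ} {A : ℕ → ℕ}

theorem cnt_pos {c : ℕ} (hc : c < m) : 0 < cnt m own (own c) :=
  card_pos.2 ⟨c, mem_filter.2 ⟨mem_range.2 hc, rfl⟩⟩

/-- Not all thresholds can be tried in vain. -/
theorem not_forall_exhausted (hn : 0 < n) (hm : 0 < m) (ha : 0 < a) (hab : a ≤ b)
    (hL : IsLabelling n m ez own D) (hfin : ∀ i < n, (n + 1) * cnt m own i ≤ D i) :
    ∃ θ ≤ (n + 1) * m + 2, ¬ Exhausted n m own D a b θ := by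
  by_contra! hex
  refine false_of_forall_unbalanced (e := cnt m own) (D := D) hn ha hab
    (fun i hi => ⟨hfin i hi, hL.le i hi⟩)
    (u := ((range m).filter (fun c => n ≤ own c)).card) ?_ (Θ := (n + 1) * m + 2)
    (fun i hi => by have := hL.bdd i hi; omega) fun θ hθ hgap hpr g hg hlow => ?_
  · by_cases h : n ≤ own 0
    · exact Or.inl (card_pos.2 ⟨0, mem_filter.2 ⟨mem_range.2 hm, h⟩⟩)
    · exact Or.inr ⟨own 0, not_le.1 h, cnt_pos hm⟩
  · have hpr' : ∃ c < m, ¬ Cheap n own D θ c := by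
      rcases hpr with h | ⟨i, hi, hiD, hi0⟩
      · obtain ⟨c, hc⟩ := card_pos.1 h
        rw [mem_filter, mem_range] at hc
        exact ⟨c, hc.1, fun h => by have := h.1; omega⟩
      · obtain ⟨c, hc⟩ := card_pos.1 hi0
        rw [mem_filter, mem_range] at hc
        refine ⟨c, hc.1, fun h => ?_⟩
        have h1 := h.2
        rw [hc.2] at h1
        omega
    have hlow' : (lower n D θ).Nonempty ∨ (∀ c < m, own c < n) ∧ g = 0 := by
      refine hlow.imp_right fun h => ⟨fun c hc => ?_, h.2⟩
      by_contra! hcon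
      exact (card_pos.2 ⟨c, mem_filter.2 ⟨mem_range.2 hc, hcon⟩⟩).ne' h.1
    obtain ⟨A, hA, htot, rfl, p, hp, q, hq, hpq⟩ := hex θ hθ hgap hpr' g hg hlow'
    refine ⟨_, hA.isConfig (ha.trans_le hab) htot, p, hp, q, hq, ?_⟩
    rwa [hA.load_eq hp, hA.load_eq hq] at hpq

omit [IsStrictOrderedRing R] in
theorem exists_min_lower (h : (lower n D θ).Nonempty) (A : ℕ → ℕ) : ∃ k ∈ lower n D θ,
    ∀ l ∈ lower n D θ, load n m own D a b θ A k ≤ load n m own D a b θ A l :=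
  exists_min_image _ _ h

/-- As long as fewer chores are moved than the upper agents own, an upper agent of maximal load
still holds a chore. -/
theorem IsAssignment.exists_max_upper (hb : 0 < b) (hA : IsAssignment n m own D a b θ A)
    (htot : ∀ c < m, A c < n) (hg : moved n m own A < ∑ i ∈ upper n D θ, cnt m own i) :
    ∃ c < m, A c ∈ upper n D θ ∧ ∀ j ∈ upper n D θ,
      load n m own D a b θ A j ≤ load n m own D a b θ A (A c) := by
  have hC := hA.isConfig hb htot
  have h1 : ∑ i ∈ upper n D θ, expensive n m own D θ A i ≠ 0 := by
    have := hC.sum_upper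
    omega
  obtain ⟨i, hi, hi0⟩ := exists_ne_zero_of_sum_ne_zero h1
  obtain ⟨j, hj, hjmax⟩ := exists_max_image _ (expensive n m own D θ A) ⟨i, hi⟩
  obtain ⟨c, hc⟩ := card_pos.1 ((Nat.pos_of_ne_zero hi0).trans_le (hjmax i hi))
  rw [mem_filter, mem_range] at hc
  obtain ⟨hc, rfl, -⟩ := hc
  refine ⟨c, hc, hj, fun k hk => ?_⟩
  rw [hA.load_eq (mem_upper.1 hj).1, hA.load_eq (mem_upper.1 hk).1, configLoad_upper hj,
    configLoad_upper hk]
  exact mul_natCast_le hb (hjmax k hk)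

theorem moved_own : moved n m own own = 0 := by simp [moved]

/-- For a gap threshold, every possible number of transfers is realized. -/
theorem exists_assignment (hb : 0 < b) {g : ℕ} (hg : g ≤ ∑ i ∈ upper n D θ, cnt m own i)
    (hlow : (lower n D θ).Nonempty ∨ (∀ c < m, own c < n) ∧ g = 0) :
    ∃ A, IsAssignment n m own D a b θ A ∧ (∀ c < m, A c < n) ∧ moved n m own A = g := by
  rcases hlow with hlow | ⟨h, rfl⟩
  swap
  · exact ⟨own, isAssignment_own, h, moved_own⟩
  have hU : ∀ t ≤ m, ∃ A, IsAssignment n m own D a b θ A ∧ (∀ c < t, A c < n) ∧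
      moved n m own A = 0 := by
    intro t
    induction t with
    | zero => exact fun _ => ⟨own, isAssignment_own, by simp, moved_own⟩
    | succ t ih =>
      intro ht
      obtain ⟨A, hA, htot, hmv⟩ := ih (by omega)
      by_cases hAt : A t < n
      · exact ⟨A, hA, fun c hc => (Nat.lt_succ_iff_lt_or_eq.1 hc).elim (htot c) (· ▸ hAt), hmv⟩
      · obtain ⟨k, hk, hmin⟩ := exists_min_lower (a := a) (b := b) hlow A
        have hk' := mem_lower.1 hk
        refine ⟨_, hA.give hb ht (Or.inl (not_lt.1 hAt)) hk hmin, fun c hc => ?_, ?_⟩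
        · rcases eq_or_ne c t with rfl | hct
          · simpa using hk'.1
          · rw [Function.update_of_ne hct]
            exact htot c (by omega)
        · rw [moved_update hA ht hk'.1 hk'.2 (Or.inl (not_lt.1 hAt)), if_neg hAt, hmv]
  induction g with
  | zero => exact hU m le_rfl
  | succ g ih =>
    obtain ⟨A, hA, htot, hmv⟩ := ih (by omega)
    obtain ⟨c, hc, hcu, hmax⟩ := hA.exists_max_upper hb htot (by omega)
    obtain ⟨k, hk, hmin⟩ := exists_min_lower (a := a) (b := b) hlow A
    have hk' := mem_lower.1 hk
    refine ⟨_, hA.give hb hc (Or.inr ⟨hcu, hmax⟩) hk hmin, fun d hd => ?_, ?_⟩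
    · rcases eq_or_ne d c with rfl | hdc
      · simpa using hk'.1
      · rw [Function.update_of_ne hdc]
        exact htot d hd
    · rw [moved_update hA hc hk'.1 hk'.2 (Or.inr (mem_upper.1 hcu)), if_pos (htot c hc), hmv]

/-- Every labelling with sufficiently large labels admits a solution. -/
theorem exists_solution (hn : 0 < n) (hm : 0 < m) (ha : 0 < a) (hab : a ≤ b)
    (hL : IsLabelling n m ez own D) (hfin : ∀ i < n, (n + 1) * cnt m own i ≤ D i) :
    ∃ θ A, IsSolution n m own D a b θ A := by
  by_contra! hcon
  obtain ⟨θ, -, hθ⟩ := not_forall_exhausted hn hm ha hab hL hfin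
  refine hθ fun hgap hpr g hg hlow => ?_
  obtain ⟨A, hA, htot, hmv⟩ := exists_assignment (a := a) (ha.trans_le hab) hg hlow
  refine ⟨A, hA, htot, hmv, ?_⟩
  by_contra! hbal
  exact hcon θ A ⟨hA, htot, hgap, hpr, fun p hp q hq => hbal p hp q hq⟩

end Solutions

/-! ### From prices to fairness and efficiency -/

section Prices

variable {n m : ℕ}

/-- An allocation in which every agent only holds chores of minimal cost per unit of price is Pareto
optimal. If moreover the prices of any two bundles differ by at most the price of one chore `c₀`,
then copies of `c₀` given to all agents except for one of maximal price remove all envy. -/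
theorem isDEF_and_isParetoOptimal_of_prices (v : Fin n → Fin m → ℝ) (A : Fin m → Fin n)
    (α : Fin n → ℝ) (π : Fin m → ℝ) (hn : 0 < n) (hα : ∀ i, 0 < α i)
    (hle : ∀ i c, π c ≤ α i * -v i c) (heq : ∀ c, α (A c) * -v (A c) c = π c) (c₀ : Fin m)
    (hbal : ∀ i j, ∑ c ∈ bundle A i, π c ≤ ∑ c ∈ bundle A j, π c + π c₀) :
    IsDEF v A (n - 1) ∧ IsParetoOptimal v A := by
  have hval : ∀ i, α i * -bundleValue v i (bundle A i) = ∑ c ∈ bundle A i, π c := by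
    intro i
    rw [bundleValue, ← sum_neg_distrib, mul_sum]
    refine sum_congr rfl fun c hc => ?_
    obtain rfl : A c = i := (mem_filter.1 hc).2
    exact heq c
  have hval' : ∀ i S, ∑ c ∈ S, π c ≤ α i * -bundleValue v i S := by
    intro i S
    rw [bundleValue, ← sum_neg_distrib, mul_sum]
    exact sum_le_sum fun c _ => hle i c
  constructor
  · obtain ⟨t, -, ht⟩ := exists_max_image (univ : Finset (Fin n))
      (fun i => ∑ c ∈ bundle A i, π c) ⟨⟨0, hn⟩, mem_univ _⟩
    refine ⟨_, fun h => if h = t then 0 else {c₀}, ?_, rfl, fun i h => ?_⟩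
    · rw [Multiset.card_sum]
      have : ∀ i : Fin n, (if i = t then (0 : Multiset (Fin m)) else {c₀}).card =
          if i = t then 0 else 1 := fun i => by split_ifs <;> simp
      simp only [this]
      rw [← add_sum_erase _ _ (mem_univ t), if_pos rfl, zero_add]
      calc _ ≤ ∑ _i ∈ univ.erase t, 1 := sum_le_sum fun i _ => by split_ifs <;> simp
        _ = n - 1 := by simp
    · rcases eq_or_ne h i with rfl | hne
      · exact le_rfl
      · rw [augmentedValue, augmentedValue, if_neg hne, if_pos rfl]
        have h1 := hval i
        have h2 := hval' i (bundle A h)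
        have h3 := ht i (mem_univ _)
        have h4 := hbal t h
        have h5 := hle i c₀
        suffices α i * -bundleValue v i (bundle A i) ≤ α i *
            -(bundleValue v i (bundle A h) +
              (((if h = t then 0 else {c₀} : Multiset (Fin m))).map (v i)).sum) by
          have := le_of_mul_le_mul_left this (hα i)
          linarith
        split_ifs with hht
        · subst hht
          simp only [Multiset.map_zero, Multiset.sum_zero, add_zero]
          linarith
        · simp only [Multiset.map_singleton, Multiset.sum_singleton]
          rw [neg_add, mul_add]
          linarith
  · rintro ⟨B, hge, i, hlt⟩
    have hsum : ∀ C : Fin m → Fin n, ∑ i, ∑ c ∈ bundle C i, π c = ∑ c, π c := fun C =>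
      sum_fiberwise_of_maps_to (g := C) (fun c _ => mem_univ _) π
    have h1 : ∑ i, α i * -bundleValue v i (bundle B i) <
        ∑ i, α i * -bundleValue v i (bundle A i) :=
      sum_lt_sum (fun j _ => mul_le_mul_of_nonneg_left (neg_le_neg (hge j)) (hα j).le)
        ⟨i, mem_univ _, mul_lt_mul_of_pos_left (neg_lt_neg hlt) (hα i)⟩
    have h2 : ∑ i, α i * -bundleValue v i (bundle A i) = ∑ c, π c := by
      rw [← hsum A]
      exact sum_congr rfl fun j _ => hval j
    have h3 : ∑ c, π c ≤ ∑ i, α i * -bundleValue v i (bundle B i) := by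
      rw [← hsum B]
      exact sum_le_sum fun j _ => hval' j _
    linarith

theorem isDEF_and_isParetoOptimal_of_isEmpty (v : Fin n → Fin 0 → ℝ) (A : Fin 0 → Fin n) :
    IsDEF v A (n - 1) ∧ IsParetoOptimal v A := by
  have h : ∀ i S, bundleValue v i S = 0 := fun i S => by simp [bundleValue, Subsingleton.elim S ∅]
  refine ⟨⟨0, fun _ => 0, by simp, by simp, fun i h => by simp [augmentedValue, *]⟩, ?_⟩
  rintro ⟨B, -, i, hi⟩
  simp [h] at hi

/-- A solution is a DEF-`(n - 1)` and Pareto-optimal allocation. After the costs of the upper agents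
have been multiplied by `b / a`, no cost is smaller than the price, and agents hold only chores whose
cost equals the price. -/
theorem IsSolution.isDEF_and_isParetoOptimal {ez : ℕ → ℕ → Prop} {own D : ℕ → ℕ} {a b : ℝ} {θ : ℕ}
    {A : ℕ → ℕ} (hn : 0 < n) (ha : 0 < a) (hab : a ≤ b) (hL : IsLabelling n m ez own D)
    (hA : IsSolution n m own D a b θ A) (v : Fin n → Fin m → ℝ)
    (hv : ∀ (i : Fin n) (c : Fin m), ez i c → v i c = -a)
    (hv' : ∀ (i : Fin n) (c : Fin m), ¬ ez i c → v i c = -b)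
    (A' : Fin m → Fin n) (hA' : ∀ c, (A' c : ℕ) = A c) :
    IsDEF v A' (n - 1) ∧ IsParetoOptimal v A' := by
  obtain ⟨c₀, hc₀, hc₀'⟩ := hA.priced
  have hb : 0 < b := ha.trans_le hab
  have hπle : ∀ c, price n own D a b θ c ≤ b := fun c => by
    rw [price]; split_ifs <;> linarith
  have hload : ∀ i : Fin n, ∑ c ∈ bundle A' i, price n own D a b θ c = load n m own D a b θ A i := by
    intro i
    rw [load, sum_range fun c => if A c = i then price n own D a b θ c else 0, bundle, sum_filter]
    refine sum_congr rfl fun c _ => if_congr ?_ rfl rfl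
    rw [← hA' c, Fin.ext_iff]
  refine isDEF_and_isParetoOptimal_of_prices v A' (fun i => if θ ≤ D i then b / a else 1)
    (fun c => price n own D a b θ c) hn (fun i => ?_) (fun i c => ?_) (fun c => ?_) ⟨c₀, hc₀⟩
    fun i j => ?_
  · split_ifs
    · positivity
    · exact one_pos
  · have hcost : a ≤ -v i c := by
      by_cases h : ez i c
      · rw [hv i c h, neg_neg]
      · rw [hv' i c h, neg_neg]; exact hab
    split_ifs with hθ
    · calc price n own D a b θ c ≤ b := hπle c
        _ = b / a * a := (div_mul_cancel₀ b ha.ne').symm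
        _ ≤ b / a * -v i c := mul_le_mul_of_nonneg_left hcost (by positivity)
    · rw [one_mul]
      by_cases h : ez i c
      · rw [hv i c h, neg_neg, price, if_pos]
        -- no lower agent finds a chore of price `b` easy, since labels drop by at most one
        -- along it and no label equals `θ - 1`
        have hcn : own c < n := by
          by_contra! hcon
          exact hL.hard c c.2 hcon i i.2 h
        have h1 := hL.valid c c.2 hcn i i.2 h
        have h2 := hA.gap i i.2
        exact ⟨hcn, by omega⟩
      · rw [hv' i c h, neg_neg]
        exact hπle c
  · have hAc := hA.total c c.2
    split_ifs with hθ
    · rw [hA'] at hθ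
      have hown := hA.kept c c.2 hAc hθ
      have hez : ez (A' c) c := by
        rw [hA', ← hown]
        exact hL.easy c c.2 (hown ▸ hAc)
      rw [hv _ _ hez, neg_neg, div_mul_cancel₀ b ha.ne', price, if_neg]
      rintro ⟨-, h⟩
      rw [hown] at h
      omega
    · rw [one_mul]
      by_cases hch : Cheap n own D θ c
      · have hown := hA.cheap c c.2 hch
        have hez : ez (A' c) c := by
          rw [hA', hown]
          exact hL.easy c c.2 hch.1
        rw [hv _ _ hez, neg_neg, price, if_pos hch]
      · have hez : ¬ ez (A' c) c := by
          intro hez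
          have hcn : own c < n := by
            by_contra! hcon
            exact hL.hard c c.2 hcon _ (A' c).2 hez
          have h1 := hL.valid c c.2 hcn _ (A' c).2 hez
          have h2 := hA.gap _ (A' c).2
          exact hch ⟨hcn, by omega⟩
        rw [hv' _ _ hez, neg_neg, price, if_neg hch]
  · rw [hload, hload, show price n own D a b θ c₀ = b from if_neg hc₀']
    exact hA.balanced i i.2 j j.2

/-- Every bivalued instance has a DEF-`(n - 1)` and Pareto-optimal allocation. -/
theorem exists_isDEF_and_isParetoOptimal (v : Fin n → Fin m → ℝ) (hn : 0 < n) (hv : IsBivalued v) :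
    ∃ A : Fin m → Fin n, IsDEF v A (n - 1) ∧ IsParetoOptimal v A := by
  obtain ⟨x, y, hxy, hy, hv⟩ := hv
  rcases Nat.eq_zero_or_pos m with rfl | hm
  · exact ⟨Fin.elim0, isDEF_and_isParetoOptimal_of_isEmpty _ _⟩
  let ez : ℕ → ℕ → Prop := fun i c => ∃ (hi : i < n) (hc : c < m), v ⟨i, hi⟩ ⟨c, hc⟩ = y
  obtain ⟨own, D, hL, hfin⟩ := exists_labelling n m ez
  obtain ⟨θ, A, hA⟩ := exists_solution hn hm (neg_pos.2 hy) (neg_le_neg hxy.le) hL hfin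
  refine ⟨fun c => ⟨A c, hA.total c c.2⟩, hA.isDEF_and_isParetoOptimal hn (neg_pos.2 hy)
    (neg_le_neg hxy.le) hL v (fun i c h => ?_) (fun i c h => ?_) _ fun c => rfl⟩
  · obtain ⟨_, _, h⟩ := h
    rw [neg_neg]
    exact h
  · rw [neg_neg]
    exact (hv i c).resolve_right fun h' => h ⟨i.2, c.2, h'⟩

end Prices

/-! ### Running times of while-programs -/

section Execution

/-- Started in `s`, the program `p` halts within `T` units of time in a state with property `Q`. -/
def Ends (p : Prog) (s : MemState) (T : ℕ) (Q : MemState → Prop) : Prop :=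
  ∃ t s', Runs p s t s' ∧ t ≤ T ∧ Q s'

theorem Ends.mono {p : Prog} {s : MemState} {T T' : ℕ} {Q Q' : MemState → Prop}
    (h : Ends p s T Q) (hT : T ≤ T') (hQ : ∀ s', Q s' → Q' s') : Ends p s T' Q' := by
  obtain ⟨t, s', h1, h2, h3⟩ := h
  exact ⟨t, s', h1, h2.trans hT, hQ s' h3⟩

theorem Ends.seq {p q : Prog} {s : MemState} {T T' : ℕ} {P Q : MemState → Prop}
    (hp : Ends p s T P) (hq : ∀ s', P s' → Ends q s' T' Q) : Ends (.seq p q) s (T + T') Q := by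
  obtain ⟨t, s', h1, h2, h3⟩ := hp
  obtain ⟨t', s'', h4, h5, h6⟩ := hq s' h3
  exact ⟨t + t', s'', .seq h1 h4, by omega, h6⟩

theorem Ends.ite {b : Cond} {p q : Prog} {s : MemState} {T : ℕ} {Q : MemState → Prop}
    (hp : b.holds s → Ends p s T Q) (hq : ¬ b.holds s → Ends q s T Q) :
    Ends (.ite b p q) s (b.cost + T + 1) Q := by
  by_cases hb : b.holds s
  · obtain ⟨t, s', h1, h2, h3⟩ := hp hb
    exact ⟨_, s', .iteTrue hb h1, by omega, h3⟩
  · obtain ⟨t, s', h1, h2, h3⟩ := hq hb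
    exact ⟨_, s', .iteFalse hb h1, by omega, h3⟩

/-- A loop whose invariant `I` carries a counter that every round decreases. -/
theorem Ends.while {b : Cond} {p : Prog} {T : ℕ} (I : ℕ → MemState → Prop)
    (hp : ∀ k s, I k s → b.holds s → Ends p s T (fun s' => ∃ k' < k, I k' s')) :
    ∀ {k : ℕ} {s : MemState}, I k s →
      Ends (.while b p) s ((k + 1) * (b.cost + T + 1)) (fun s' => ∃ k', I k' s' ∧ ¬ b.holds s') := by
  intro k
  induction k using Nat.strong_induction_on with
  | _ k ih =>
  intro s hs
  by_cases hb : b.holds s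
  · obtain ⟨t, s', h1, h2, k', hk', h3⟩ := hp k s hs hb
    obtain ⟨t', s'', h4, h5, h6⟩ := ih k' hk' h3
    refine ⟨_, s'', .whileTrue hb h1 h4, ?_, h6⟩
    have : (k' + 1 + 1) * (b.cost + T + 1) ≤ (k + 1) * (b.cost + T + 1) :=
      Nat.mul_le_mul_right _ (by omega)
    rw [add_mul (k' + 1)] at this
    omega
  · refine ⟨_, s, .whileFalse hb, ?_, k, hs, hb⟩
    rw [add_mul]
    omega

/-- Programs without loops. -/
def Flat : Prog → Prop
  | .skip => True
  | .assign _ _ => True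
  | .write _ _ _ _ => True
  | .seq p q => Flat p ∧ Flat q
  | .ite _ p q => Flat p ∧ Flat q
  | .while _ _ => False

/-- A bound for the running time of a program without loops. -/
def flatCost : Prog → ℕ
  | .skip => 1
  | .assign _ e => e.cost + 1
  | .write _ e f g => e.cost + f.cost + g.cost + 1
  | .seq p q => flatCost p + flatCost q
  | .ite b p q => b.cost + (flatCost p + flatCost q) + 1
  | .while _ _ => 0

open Classical in
/-- The state in which a program without loops halts. -/
noncomputable def exec : Prog → MemState → MemState
  | .skip, s => s
  | .assign x e, s => s.setReg x (e.eval s)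
  | .write a e f g, s => s.setTab a (e.eval s).toNat (f.eval s).toNat (g.eval s)
  | .seq p q, s => exec q (exec p s)
  | .ite b p q, s => if b.holds s then exec p s else exec q s
  | .while _ _, s => s

theorem Ends.flat {p : Prog} (hp : Flat p) {s : MemState} {Q : MemState → Prop}
    (h : Q (exec p s)) : Ends p s (flatCost p) Q := by
  induction p generalizing s Q with
  | skip => exact ⟨_, _, .skip s, le_rfl, h⟩
  | assign x e => exact ⟨_, _, .assign s x e, le_rfl, h⟩
  | write a e f g => exact ⟨_, _, .write s a e f g, le_rfl, h⟩
  | seq p q ihp ihq => exact Ends.seq (ihp hp.1 rfl) (by rintro s' rfl; exact ihq hp.2 h)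
  | ite b p q ihp ihq =>
    refine Ends.ite (fun hb => (ihp hp.1 ?_).mono (by omega) fun _ => id)
      (fun hb => (ihq hp.2 ?_).mono (by omega) fun _ => id)
    · rwa [exec, if_pos hb] at h
    · rwa [exec, if_neg hb] at h
  | _ => exact hp.elim

/-- `for x = 0, …, N - 1 do p`, where the bound `N` is the content of a register. -/
def forLoop (x N : ℕ) (p : Prog) : Prog :=
  .seq (.assign x (.const 0))
    (.while (.lt (.var x) (.var N)) (.seq p (.assign x (.add (.var x) (.const 1)))))

theorem Ends.forLoop {x N : ℕ} {p : Prog} {T k w : ℕ} (I : ℕ → MemState → Prop) (hk : k < w)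
    (hN : ∀ j s, I j s → s.reg N = k)
    (hp : ∀ j < k, ∀ s, I j s → s.reg x = j →
      Ends p s T (fun s' => s'.reg x = j ∧ I (j + 1) (s'.setReg x (j + 1))))
    {s : MemState} (hs : I 0 (s.setReg x 0)) :
    Ends (forLoop x N p) s (w * (T + 10)) (fun s' => I k s') := by
  have h1 : Ends (.assign x (.const 0)) s 2 (fun s' => ∃ j ≤ k, s'.reg x = j ∧ I j s' ∧ k - j = k) :=
    ⟨_, _, .assign s x _, le_rfl, 0, Nat.zero_le _, by simp [MemState.setReg, Expr.eval], hs, rfl⟩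
  have h2 := Ends.seq h1 (q := .while (.lt (.var x) (.var N))
      (.seq p (.assign x (.add (.var x) (.const 1)))))
    (T' := (k + 1) * (3 + (T + 4) + 1)) (Q := fun s' => I k s') ?_
  · refine h2.mono ?_ fun _ => id
    have : (k + 1) * (T + 10) ≤ w * (T + 10) := Nat.mul_le_mul_right _ hk
    have h3 : (k + 1) * (T + 10) = (k + 1) * (3 + (T + 4) + 1) + (k + 1) * 2 := by ring
    omega
  · rintro s' ⟨j, hj, hsj, hI, hfuel⟩
    have h3 := Ends.while (b := .lt (.var x) (.var N))
      (p := .seq p (.assign x (.add (.var x) (.const 1)))) (T := T + 4)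
      (fun f s => ∃ j ≤ k, s.reg x = j ∧ I j s ∧ k - j = f) ?_ ⟨j, hj, hsj, hI, hfuel⟩
    · refine h3.mono le_rfl ?_
      rintro s'' ⟨f, ⟨j, hj, hsj, hI, -⟩, hb⟩
      have h4 := hN j s'' hI
      simp only [Cond.holds, Expr.eval, hsj, h4, Nat.cast_lt, not_lt] at hb
      rwa [le_antisymm hj hb] at hI
    · rintro f t ⟨j, hj, htj, hI, hf⟩ hb
      have h4 := hN j t hI
      simp only [Cond.holds, Expr.eval, htj, h4, Nat.cast_lt] at hb
      refine Ends.seq (hp j hb t hI htj) ?_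
      rintro t' ⟨h5, h6⟩
      refine ⟨_, _, .assign t' x _, le_rfl, k - (j + 1), by omega, j + 1, hb, ?_, ?_, rfl⟩
      · simp [MemState.setReg, Expr.eval, h5]
      · simpa [Expr.eval, h5] using h6

/-- Agreement of two states up to the scratch registers `6`, `7` and `8`, the only memory that
`argmax` changes. -/
def Agree (s s' : MemState) : Prop :=
  s'.tab = s.tab ∧ ∀ x, x ≠ 6 → x ≠ 7 → x ≠ 8 → s'.reg x = s.reg x

/-- Search for an index `j`, less than the content of register `N`, that satisfies the condition `b`
and maximizes the expression `e` among all such indices. The index is available to `b` and `e` in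
register `6`. The result is stored in register `7`; it is the content of register `N` if there is no
such index. -/
def argmax (N : ℕ) (b : Cond) (e : Expr) : Prog :=
  .seq (.assign 7 (.var N)) (forLoop 6 N
    (.ite (.and b (.or (.eq (.var 7) (.var N)) (.lt (.var 8) e)))
      (.seq (.assign 7 (.var 6)) (.assign 8 e)) .skip))

/-- The value `r` is the result of a search for the maximum of `V` subject to `B` below `k`. -/
def IsArgmax (k : ℕ) (B : ℕ → Prop) (V : ℕ → ℤ) (r : ℤ) : Prop :=
  (r = k ∧ ∀ j < k, ¬ B j) ∨ ∃ i : ℕ, r = i ∧ i < k ∧ B i ∧ ∀ j < k, B j → V j ≤ V i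

theorem Ends.argmax {N : ℕ} {b : Cond} {e : Expr} {s : MemState} {k w : ℕ} (B : ℕ → Prop)
    (V : ℕ → ℤ) (hN6 : N ≠ 6) (hN7 : N ≠ 7) (hN8 : N ≠ 8) (hk : s.reg N = k) (hw : k < w)
    (hB : ∀ j < k, ∀ s', Agree s s' → s'.reg 6 = j → (b.holds s' ↔ B j))
    (hV : ∀ j < k, ∀ s', Agree s s' → s'.reg 6 = j → e.eval s' = V j) :
    Ends (argmax N b e) s (2 + w * (b.cost + 2 * e.cost + 22))
      (fun s' => Agree s s' ∧ IsArgmax k B V (s'.reg 7)) := by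
  refine (Ends.seq (P := fun t => Agree s t ∧ t.reg 7 = k)
    (Q := fun s' => Agree s s' ∧ IsArgmax k B V (s'.reg 7)) ⟨_, _, .assign _ _ _, le_rfl, ?_⟩ ?_).mono
      le_rfl fun s' hs' => hs'
  · refine ⟨⟨rfl, fun x _ h7 _ => ?_⟩, ?_⟩
    · simp [MemState.setReg, h7]
    · simp [MemState.setReg, Expr.eval, hk]
  rintro t ⟨hst, ht7⟩
  refine (Ends.forLoop (T := b.cost + 2 * e.cost + 12) (k := k) (w := w) (fun j s' => Agree s s' ∧
    ((s'.reg 7 = k ∧ ∀ i < j, ¬ B i) ∨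
      ∃ i : ℕ, s'.reg 7 = i ∧ i < k ∧ s'.reg 8 = V i ∧ B i ∧ ∀ l < j, B l → V l ≤ V i)) hw ?_ ?_
      ?_).mono (by rw [add_assoc]) ?_
  · rintro j s' ⟨h1, -⟩
    rw [h1.2 N hN6 hN7 hN8, hk]
  · rintro j hj s' ⟨h1, h2⟩ hsj
    have hBj := hB j hj s' h1 hsj
    have hVj := hV j hj s' h1 hsj
    have hNk : s'.reg N = k := by rw [h1.2 N hN6 hN7 hN8, hk]
    have hVj' : e.eval (s'.setReg 7 j) = V j := by
      refine hV j hj _ ⟨h1.1, fun x h6 h7 h8 => ?_⟩ ?_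
      · simp [MemState.setReg, h7, h1.2 x h6 h7 h8]
      · simp [MemState.setReg, hsj]
    refine (Ends.ite (T := e.cost + 3) (fun hb => ?_) (fun hb => ?_)).mono ?_ fun _ h => h
    · simp only [Cond.holds, hBj, hVj, Expr.eval, hNk] at hb
      refine (Ends.flat (p := .seq (.assign 7 (.var 6)) (.assign 8 e)) ⟨trivial, trivial⟩ ?_).mono ?_
        fun _ h => h
      · simp only [exec, Expr.eval, hsj, hVj']
        refine ⟨by simp [MemState.setReg, hsj], ⟨h1.1, fun x h6 h7 h8 => ?_⟩, Or.inr ⟨j, ?_, hj, ?_,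
          hb.1, fun l hl hBl => ?_⟩⟩
        · simp [MemState.setReg, h6, h7, h8, h1.2 x h6 h7 h8]
        · simp [MemState.setReg]
        · simp [MemState.setReg]
        · rcases Nat.lt_succ_iff_lt_or_eq.1 hl with hl | rfl
          · rcases h2 with ⟨-, h2⟩ | ⟨i, h3, h4, h5, -, h6⟩
            · exact absurd hBl (h2 l hl)
            · have := h6 l hl hBl
              rcases hb.2 with hb | hb
              · rw [h3] at hb
                omega
              · omega
          · exact le_rfl
      · simp only [flatCost, Expr.cost]
        omega
    · simp only [Cond.holds, hBj, hVj, Expr.eval, hNk] at hb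
      refine (Ends.flat (p := .skip) trivial ?_).mono ?_ fun _ h => h
      · refine ⟨hsj, ⟨h1.1, fun x h6 h7 h8 => ?_⟩, ?_⟩
        · simp [MemState.setReg, exec, h6, h1.2 x h6 h7 h8]
        · simp only [MemState.setReg, exec]
          rcases h2 with ⟨h2, h3⟩ | ⟨i, h3, h4, h5, h6, h7⟩
          · refine Or.inl ⟨by simpa using h2, fun i hi hBi => ?_⟩
            rcases Nat.lt_succ_iff_lt_or_eq.1 hi with hi | rfl
            · exact h3 i hi hBi
            · exact hb ⟨hBi, Or.inl h2⟩
          · refine Or.inr ⟨i, by simpa using h3, h4, by simpa using h5, h6, fun l hl hBl => ?_⟩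
            rcases Nat.lt_succ_iff_lt_or_eq.1 hl with hl | rfl
            · exact h7 l hl hBl
            · by_contra! hcon
              exact hb ⟨hBl, Or.inr (by omega)⟩
      · simp only [flatCost]
        omega
    · simp only [Cond.cost, Expr.cost]
      omega
  · refine ⟨⟨hst.1, fun x h6 h7 h8 => ?_⟩, Or.inl ⟨?_, by simp⟩⟩
    · simp [MemState.setReg, h6, hst.2 x h6 h7 h8]
    · simpa [MemState.setReg] using ht7
  · rintro s' ⟨h1, h2⟩
    refine ⟨h1, ?_⟩
    rcases h2 with h2 | ⟨i, h3, h4, -, h6, h7⟩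
    · exact Or.inl h2
    · exact Or.inr ⟨i, h3, h4, h6, h7⟩

end Execution

/-! ### Computation of the costs and the first owners -/

section Preparation

/-- The registers `0` to `4` hold `n`, `m`, `n + 1`, the larger cost `b` and the smaller cost `a`, and
table `0` holds the values. -/
structure HoldsCosts (n m : ℕ) (v : ℕ → ℕ → ℤ) (a b : ℤ) (s : MemState) : Prop where
  reg0 : s.reg 0 = n
  reg1 : s.reg 1 = m
  reg2 : s.reg 2 = n + 1
  reg3 : s.reg 3 = b
  reg4 : s.reg 4 = a
  tab0 : s.tab 0 = v

variable {n m : ℕ} {v : ℕ → ℕ → ℤ} {a b : ℤ}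

theorem HoldsCosts.congr {s s' : MemState} (h : HoldsCosts n m v a b s)
    (ht : s'.tab 0 = s.tab 0) (hr : ∀ x < 5, s'.reg x = s.reg x) : HoldsCosts n m v a b s' :=
  ⟨by rw [hr 0 (by omega), h.reg0], by rw [hr 1 (by omega), h.reg1],
    by rw [hr 2 (by omega), h.reg2], by rw [hr 3 (by omega), h.reg3],
    by rw [hr 4 (by omega), h.reg4], by rw [ht, h.tab0]⟩

theorem setReg_of_lt {s : MemState} {x y k : ℕ} {z : ℤ} (hx : k ≤ x) (hy : y < k) :
    (s.setReg x z).reg y = s.reg y := by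
  simp [MemState.setReg, (hy.trans_le hx).ne]

theorem setReg_eq_self {s : MemState} {x : ℕ} {z : ℤ} (h : s.reg x = z) : s.setReg x z = s := by
  subst h
  cases s
  simp only [MemState.setReg, MemState.mk.injEq, and_true]
  funext y
  split_ifs with hy
  · rw [hy]
  · rfl

theorem Agree.reg_of_lt {s s' : MemState} (h : Agree s s') {y : ℕ} (hy : y < 6) :
    s'.reg y = s.reg y :=
  h.2 y (by omega) (by omega) (by omega)

/-- The cost of the chore with index in register `9` to the agent with index in register `10`. -/
def costExpr : Expr := .sub (.const 0) (.read 0 (.var 10) (.var 9))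

/-- Computation of the smallest and the largest cost. -/
def computeCosts : Prog :=
  .seq (.seq (.assign 2 (.add (.var 0) (.const 1)))
    (.seq (.assign 3 (.sub (.const 0) (.read 0 (.const 0) (.const 0)))) (.assign 4 (.var 3))))
    (forLoop 9 1 (forLoop 10 0
      (.seq (.ite (.lt (.var 3) costExpr) (.assign 3 costExpr) .skip)
        (.ite (.lt costExpr (.var 4)) (.assign 4 costExpr) .skip))))

/-- A bound for the running time, where `w` exceeds the numbers of agents and chores. Such bounds are
stated over an arbitrary semiring, so that the same expression stands for a number and for the
polynomial that has this number as a value. Their constants are generous. -/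
def computeCostsTime {R : Type*} [Semiring R] (w : R) : R := 15 + w * (w * (50 + 10) + 10)

/-- The numbers `a` and `b` are costs of some agents for some chores, and all costs of the pairs in `P`
lie between them. -/
structure IsExtreme (n m : ℕ) (v : ℕ → ℕ → ℤ) (P : ℕ → ℕ → Prop) (a b : ℤ) : Prop where
  bound : ∀ i < n, ∀ c < m, P i c → a ≤ -v i c ∧ -v i c ≤ b
  min_mem : ∃ i < n, ∃ c < m, a = -v i c
  max_mem : ∃ i < n, ∃ c < m, b = -v i c

theorem ends_computeCosts (hn : 0 < n) (hm : 0 < m) {w : ℕ} (hnw : n < w) (hmw : m < w)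
    {s : MemState} (h0 : s.reg 0 = n) (h1 : s.reg 1 = m) (hv : s.tab 0 = v) :
    Ends computeCosts s (computeCostsTime w) (fun s' => s'.tab = s.tab ∧
      ∃ a b, HoldsCosts n m v a b s' ∧ IsExtreme n m v (fun _ _ => True) a b) := by
  refine (Ends.seq (P := fun s' => s'.tab = s.tab ∧
      ∃ a b, HoldsCosts n m v a b s' ∧ IsExtreme n m v (fun _ _ => False) a b)
      ((Ends.flat (by simp [Flat]) ?_).mono (show _ ≤ 15 by decide) fun _ => id)
      (T' := w * (w * (50 + 10) + 10)) ?_).mono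
      (by simp [computeCostsTime]) fun _ => id
  · refine ⟨rfl, -v 0 0, -v 0 0, ⟨?_, ?_, ?_, ?_, ?_, ?_⟩, ⟨by simp, ⟨0, hn, 0, hm, rfl⟩,
      ⟨0, hn, 0, hm, rfl⟩⟩⟩ <;> simp [exec, MemState.setReg, Expr.eval, h0, h1, hv]
  rintro s₁ ⟨ht, a, b, hc, he⟩
  refine (Ends.forLoop (k := m) (fun k s' => s'.tab = s.tab ∧
      ∃ a b, HoldsCosts n m v a b s' ∧ IsExtreme n m v (fun _ c => c < k) a b) hmw ?_ ?_ ?_).mono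
      le_rfl ?_
  · rintro j s' ⟨-, a, b, h, -⟩
    exact h.reg1
  · rintro c hc s₂ ⟨ht, a, b, h, he⟩ h9
    refine (Ends.forLoop (k := n) (fun i s' => s'.tab = s.tab ∧ s'.reg 9 = c ∧
      ∃ a b, HoldsCosts n m v a b s' ∧
        IsExtreme n m v (fun j d => d < c ∨ d = c ∧ j < i) a b) hnw ?_ ?_ ?_).mono le_rfl ?_
    · rintro j s' ⟨-, -, a, b, h, -⟩
      exact h.reg0
    · rintro i hi s₃ ⟨ht, h9, a, b, h, he⟩ h10
      refine (Ends.flat (by simp [Flat]) ?_).mono (show _ ≤ 50 by decide) fun _ => id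
      have hcost : ∀ t : MemState, t.tab = s₃.tab → t.reg 9 = c → t.reg 10 = i →
          costExpr.eval t = -v i c := by
        intro t ht h9 h10
        simp [costExpr, Expr.eval, ht, h9, h10, h.tab0]
      -- the new costs
      have hnew : IsExtreme n m v (fun j d => d < c ∨ d = c ∧ j < i + 1)
          (if -v i c < a then -v i c else a) (if b < -v i c then -v i c else b) := by
        refine ⟨fun j hj d hd hP => ?_, ?_, ?_⟩
        · by_cases h1 : d = c ∧ j = i
          · obtain ⟨rfl, rfl⟩ := h1
            constructor <;> split_ifs <;> omega
          · have := he.bound j hj d hd (by omega)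
            constructor <;> split_ifs <;> omega
        · split_ifs
          · exact ⟨i, hi, c, hc, rfl⟩
          · exact he.min_mem
        · split_ifs
          · exact ⟨i, hi, c, hc, rfl⟩
          · exact he.max_mem
      have hE₁ : exec (.ite (.lt (.var 3) costExpr) (.assign 3 costExpr) .skip) s₃ =
          s₃.setReg 3 (if b < -v i c then -v i c else b) := by
        have h3 := h.reg3
        simp only [exec, Cond.holds, Expr.eval, h3, hcost s₃ rfl h9 h10]
        split_ifs with h4
        · rfl
        · exact (setReg_eq_self h3).symm
      have hE₂ : ∀ z, exec (.ite (.lt costExpr (.var 4)) (.assign 4 costExpr) .skip)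
          (s₃.setReg 3 z) = (s₃.setReg 3 z).setReg 4 (if -v i c < a then -v i c else a) := by
        intro z
        have h4 : (s₃.setReg 3 z).reg 4 = a := by simp [MemState.setReg, h.reg4]
        simp only [exec, Cond.holds, Expr.eval, h4,
          hcost (s₃.setReg 3 z) rfl (by simp [MemState.setReg, h9])
            (by simp [MemState.setReg, h10])]
        split_ifs with h5
        · rfl
        · exact (setReg_eq_self h4).symm
      rw [exec, hE₁, hE₂]
      refine ⟨by simp [MemState.setReg, h10], ht, by simp [MemState.setReg, h9], _, _,
        ⟨?_, ?_, ?_, ?_, ?_, ?_⟩, hnew⟩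
      · simp [MemState.setReg, h.reg0]
      · simp [MemState.setReg, h.reg1]
      · simp [MemState.setReg, h.reg2]
      · simp [MemState.setReg]
      · simp [MemState.setReg]
      · exact h.tab0
    · refine ⟨ht, by simp [MemState.setReg, h9], a, b,
        h.congr rfl fun x hx => setReg_of_lt (by omega) hx, ?_⟩
      exact ⟨fun i hi d hd hP => he.bound i hi d hd (by omega), he.min_mem, he.max_mem⟩
    · rintro s' ⟨ht, h9, a, b, h, he⟩
      refine ⟨h9, ht, a, b, h.congr rfl fun x hx => setReg_of_lt (by omega) hx, ?_⟩
      exact ⟨fun i hi d hd hP => he.bound i hi d hd (by omega), he.min_mem, he.max_mem⟩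
  · refine ⟨ht, a, b, hc.congr rfl fun x hx => setReg_of_lt (by omega) hx, ?_⟩
    exact ⟨by simp, he.min_mem, he.max_mem⟩
  · rintro s' ⟨ht, a, b, h, he⟩
    exact ⟨ht, a, b, h, fun i hi c hc _ => he.bound i hi c hc hc, he.min_mem, he.max_mem⟩

/-- Table `2` holds the owners of the first `k` chores, table `3` holds `n + 1` times the numbers of
these chores owned by the agents, and table `4` holds the labels. -/
structure HoldsLabels (n m : ℕ) (v : ℕ → ℕ → ℤ) (a b : ℤ) (k : ℕ) (own D : ℕ → ℕ)
    (s : MemState) : Prop extends HoldsCosts n m v a b s where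
  owner : ∀ c < k, s.tab 2 c 0 = own c
  count : ∀ i < n, s.tab 3 i 0 = ((n + 1) * cnt k own i : ℕ)
  label : ∀ i < n, s.tab 4 i 0 = D i

variable {k : ℕ} {own D : ℕ → ℕ}

theorem HoldsLabels.congr {s s' : MemState} (h : HoldsLabels n m v a b k own D s)
    (ht : ∀ a, a = 0 ∨ a = 2 ∨ a = 3 ∨ a = 4 → s'.tab a = s.tab a)
    (hr : ∀ x < 5, s'.reg x = s.reg x) : HoldsLabels n m v a b k own D s' :=
  ⟨h.toHoldsCosts.congr (ht 0 (by simp)) hr, fun c hc => by rw [ht 2 (by simp), h.owner c hc],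
    fun i hi => by rw [ht 3 (by simp), h.count i hi], fun i hi => by rw [ht 4 (by simp), h.label i hi]⟩

theorem HoldsLabels.agree {s s' : MemState} (h : HoldsLabels n m v a b k own D s)
    (hs : Agree s s') : HoldsLabels n m v a b k own D s' :=
  h.congr (fun _ _ => by rw [hs.1]) fun _ hx => hs.reg_of_lt (hx.trans (by omega))

theorem HoldsLabels.setReg {s : MemState} (h : HoldsLabels n m v a b k own D s) {x : ℕ} {z : ℤ}
    (hx : 5 ≤ x) : HoldsLabels n m v a b k own D (s.setReg x z) :=
  h.congr (fun _ _ => rfl) fun _ hy => setReg_of_lt hx hy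

/-- Agent `i` finds chore `c` easy. -/
def Easy (v : ℕ → ℕ → ℤ) (a : ℤ) (i c : ℕ) : Prop := v i c + a = 0

/-- The condition that the agent in register `6` finds the chore in register `9` easy. -/
def easyCond : Cond := .eq (.add (.read 0 (.var 6) (.var 9)) (.var 4)) (.const 0)

/-- Every chore is assigned to an agent who finds it easy, or to the dummy agent `n`. -/
def initOwners : Prog :=
  forLoop 9 1 (.seq (argmax 0 easyCond (.const 0))
    (.seq (.write 2 (.var 9) (.const 0) (.var 7))
      (.write 3 (.var 7) (.const 0) (.add (.read 3 (.var 7) (.const 0)) (.var 2)))))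

def initOwnersTime {R : Type*} [Semiring R] (w : R) : R := w * (w * 40 + 50)

theorem easyCond_holds {s s' : MemState} (h : HoldsCosts n m v a b s) (hs : Agree s s') {i c : ℕ}
    (h9 : s.reg 9 = c) (h6 : s'.reg 6 = i) : easyCond.holds s' ↔ Easy v a i c := by
  simp [easyCond, Cond.holds, Expr.eval, Easy, hs.1, h.tab0, h6, hs.2 9, h9, hs.2 4, h.reg4]

theorem cnt_succ (k : ℕ) (own : ℕ → ℕ) (i : ℕ) :
    cnt (k + 1) own i = cnt k own i + if own k = i then 1 else 0 := by
  simp only [cnt, card_filter, sum_range_succ]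

theorem cnt_congr {own own' : ℕ → ℕ} (h : ∀ c < k, own c = own' c) (i : ℕ) :
    cnt k own i = cnt k own' i := by
  rw [cnt, cnt]
  congr 1
  exact filter_congr fun c hc => by rw [h c (mem_range.1 hc)]

theorem ends_initOwners {w : ℕ} (hnw : n < w) (hmw : m < w) {s : MemState}
    (hc : HoldsCosts n m v a b s) (h3 : ∀ i, s.tab 3 i 0 = 0) (h4 : ∀ i, s.tab 4 i 0 = 0) :
    Ends initOwners s (initOwnersTime w) (fun s' => ∃ own,
      HoldsLabels n m v a b m own (fun _ => 0) s' ∧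
        IsLabelling n m (Easy v a) own (fun _ => 0)) := by
  refine (Ends.forLoop (k := m) (fun k s' => ∃ own,
      HoldsLabels n m v a b k own (fun _ => 0) s' ∧
        IsLabelling n k (Easy v a) own (fun _ => 0)) (T := w * 40 + 40) hmw ?_ ?_ ?_).mono ?_ ?_
  · rintro j s' ⟨own, h, -⟩
    exact h.reg1
  · rintro c hc s₁ ⟨own, h, hL⟩ h9
    refine (Ends.seq (Ends.argmax (Easy v a · c) (fun _ => 0) (by simp) (by simp) (by simp) h.reg0
      hnw (fun j _ s' hs' h6 => easyCond_holds h.toHoldsCosts hs' h9 h6) fun _ _ _ _ _ => rfl)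
      (T' := 38) (fun s₂ hs₂ => ?_)).mono ?_ fun _ => id
    swap
    · simp only [easyCond, Cond.cost, Expr.cost]
      omega
    obtain ⟨hs₂, hmax⟩ := hs₂
    -- the new owner
    obtain ⟨j, h7, hj, hj'⟩ : ∃ j : ℕ, s₂.reg 7 = j ∧ (j < n → Easy v a j c) ∧
        (n ≤ j → ∀ i < n, ¬ Easy v a i c) := by
      rcases hmax with ⟨h1, h2⟩ | ⟨j, h1, h2, h3, -⟩
      · exact ⟨n, h1, fun h => absurd h (lt_irrefl _), fun _ => h2⟩
      · exact ⟨j, h1, fun _ => h3, fun h => absurd h2 (not_lt.2 h)⟩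
    have h' := h.agree hs₂
    have h9' : s₂.reg 9 = c := by rw [hs₂.2 9 (by simp) (by simp) (by simp), h9]
    have hold : ∀ d < c, Function.update own c j d = own d := fun d hd =>
      Function.update_of_ne hd.ne _ _
    refine (Ends.flat (by simp [Flat]) ?_).mono (show _ ≤ 38 by decide) fun _ => id
    refine ⟨by simp [exec, MemState.setTab, h9'], Function.update own c j, ?_, ?_⟩
    · refine HoldsLabels.setReg ⟨h'.toHoldsCosts.congr ?_ fun x hx => ?_, fun d hd => ?_,
        fun i hi => ?_, fun i hi => ?_⟩ (by omega)
      · simp [exec, MemState.setTab]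
      · simp [exec, MemState.setTab]
      · rcases eq_or_ne d c with rfl | hdc
        · simp [exec, MemState.setTab, Expr.eval, h9', h7]
        · have := h'.owner d (by omega)
          simp [exec, MemState.setTab, Expr.eval, h9', hdc, this]
      · have h5 := h'.count i hi
        have h2 := h'.reg2
        rw [cnt_succ, cnt_congr hold, Function.update_self]
        simp only [exec, MemState.setTab, Expr.eval, h7]
        by_cases hij : i = j
        · subst hij
          simp [h5, h2, mul_add]
        · simp [hij, Ne.symm hij, h5]
      · have := h'.label i hi
        simp [exec, MemState.setTab, this]
    · refine ⟨fun d hd => ?_, fun d hd => ?_, by simp, by simp, by simp⟩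
      all_goals rcases Nat.lt_succ_iff_lt_or_eq.1 hd with hd' | rfl
      · rw [hold d hd']
        exact hL.easy d hd'
      · simpa using hj
      · rw [hold d hd']
        exact hL.hard d hd'
      · simpa using hj'
  · refine ⟨fun _ => 0, ⟨hc.congr rfl fun x hx => setReg_of_lt (by omega) hx, by simp,
      fun i _ => ?_, fun i _ => ?_⟩, ⟨by simp, by simp, by simp, by simp, by simp⟩⟩
    · simpa [MemState.setReg, cnt] using h3 i
    · simpa [MemState.setReg] using h4 i
  · simp only [initOwnersTime]
    exact Nat.mul_le_mul_left _ (by omega)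
  · exact fun s' hs' => hs'

end Preparation

/-! ### Computation of the labels -/

section Balancing

variable {n m : ℕ} {v : ℕ → ℕ → ℤ} {a b : ℤ} {own D : ℕ → ℕ}

/-- If the owner of the chore in register `9` has a label that is too small for the number of its
chores, the chore moves to an agent of minimal label among those who find it easy, provided that this
label is smaller. Register `11` records that something has changed. -/
def moveStep : Prog :=
  .seq (.assign 10 (.read 2 (.var 9) (.const 0)))
    (.ite (.and (.lt (.var 10) (.var 0))
        (.lt (.read 4 (.var 10) (.const 0)) (.read 3 (.var 10) (.const 0))))
      (.seq (argmax 0 easyCond (.sub (.const 0) (.read 4 (.var 6) (.const 0))))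
        (.ite (.lt (.read 4 (.var 7) (.const 0)) (.read 4 (.var 10) (.const 0)))
          (.seq (.write 3 (.var 10) (.const 0) (.sub (.read 3 (.var 10) (.const 0)) (.var 2)))
            (.seq (.write 3 (.var 7) (.const 0) (.add (.read 3 (.var 7) (.const 0)) (.var 2)))
              (.seq (.write 2 (.var 9) (.const 0) (.var 7)) (.assign 11 (.const 1)))))
          .skip))
      .skip)

/-- The label of the agent in register `9` is raised if it is too small for the number of its
chores. -/
def raiseStep : Prog :=
  .ite (.lt (.read 4 (.var 9) (.const 0)) (.read 3 (.var 9) (.const 0)))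
    (.seq (.write 4 (.var 9) (.const 0) (.add (.read 4 (.var 9) (.const 0)) (.const 1)))
      (.assign 11 (.const 1)))
    .skip

/-- Chores are moved, and when no move is possible labels are raised, until all labels are as large
as the numbers of owned chores require. -/
def balanceLabels : Prog :=
  .seq (.assign 11 (.const 1)) (.while (.eq (.var 11) (.const 1))
    (.seq (.assign 11 (.const 0)) (.seq (forLoop 9 1 moveStep)
      (.ite (.eq (.var 11) (.const 0)) (forLoop 9 0 raiseStep) .skip))))

def moveStepTime {R : Type*} [Semiring R] (w : R) : R := w * 50 + 80

def roundTime {R : Type*} [Semiring R] (w : R) : R :=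
  2 + (w * (moveStepTime w + 10) + (w * (40 + 10) + 10))

def balanceLabelsTime {R : Type*} [Semiring R] (w : R) : R :=
  2 + (w ^ 4 + 2) * (roundTime w + 4)

/-- No move of the chore `c` is called for. -/
def Stuck (n m : ℕ) (v : ℕ → ℕ → ℤ) (a : ℤ) (own D : ℕ → ℕ) (c : ℕ) : Prop :=
  own c < n → D (own c) < (n + 1) * cnt m own (own c) → ∀ j < n, Easy v a j c → D (own c) ≤ D j

/-- Register `11` is set if the potential has dropped below `p`; otherwise `P` holds. -/
def Progress (n m : ℕ) (own D : ℕ → ℕ) (p : ℕ) (P : Prop) (s : MemState) : Prop :=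
  (s.reg 11 = 1 ∧ potential n m own D < p) ∨ (s.reg 11 = 0 ∧ potential n m own D ≤ p ∧ P)

theorem Progress.le {p : ℕ} {P : Prop} {s : MemState} (h : Progress n m own D p P s) :
    potential n m own D ≤ p := by
  rcases h with h | h
  · exact h.2.le
  · exact h.2.1

theorem Progress.imp {p : ℕ} {P P' : Prop} {s s' : MemState} (h : Progress n m own D p P s)
    (hs : s'.reg 11 = s.reg 11) (hP : P → P') : Progress n m own D p P' s' := by
  rw [Progress, hs]
  exact h.imp_right fun h => ⟨h.1, h.2.1, hP h.2.2⟩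

theorem ends_moveStep {w c p : ℕ} (hnw : n < w) (hc : c < m) {s : MemState}
    (h : HoldsLabels n m v a b m own D s) (hL : IsLabelling n m (Easy v a) own D) (h9 : s.reg 9 = c)
    (hp : Progress n m own D p (∀ d < c, Stuck n m v a own D d) s) :
    Ends moveStep s (moveStepTime w) (fun s' => s'.reg 9 = c ∧ ∃ own D,
      HoldsLabels n m v a b m own D s' ∧ IsLabelling n m (Easy v a) own D ∧
        Progress n m own D p (∀ d < c + 1, Stuck n m v a own D d) s') := by
  have hown : s.tab 2 c 0 = own c := h.owner c hc
  refine (Ends.seq (P := fun s' => s' = s.setReg 10 (own c)) (T' := w * 50 + 70)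
    ⟨_, _, .assign _ _ _, le_rfl, by simp [Expr.eval, h9, hown]⟩ ?_).mono ?_ fun _ => id
  swap
  · simp only [moveStepTime, Expr.cost]
    omega
  rintro _ rfl
  set s₁ := s.setReg 10 (own c) with hs₁
  have h1 : HoldsLabels n m v a b m own D s₁ := h.setReg (by omega)
  have h19 : s₁.reg 9 = c := by simp [hs₁, MemState.setReg, h9]
  have h110 : s₁.reg 10 = own c := by simp [hs₁, MemState.setReg]
  have hp1 : Progress n m own D p (∀ d < c, Stuck n m v a own D d) s₁ :=
    hp.imp (by simp [hs₁, MemState.setReg]) id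
  have hsucc : Stuck n m v a own D c → (∀ d < c, Stuck n m v a own D d) →
      ∀ d < c + 1, Stuck n m v a own D d := fun h1 h2 d hd => by
    rcases Nat.lt_succ_iff_lt_or_eq.1 hd with hd | rfl
    · exact h2 d hd
    · exact h1
  have hcond : (Cond.and (.lt (.var 10) (.var 0))
      (.lt (.read 4 (.var 10) (.const 0)) (.read 3 (.var 10) (.const 0)))).holds s₁ ↔
        own c < n ∧ D (own c) < (n + 1) * cnt m own (own c) := by
    simp only [Cond.holds, Expr.eval, h110, h1.reg0, Nat.cast_lt, Int.toNat_natCast]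
    refine and_congr_right fun hcn => ?_
    simp only [Int.toNat_zero]
    rw [h1.label _ hcn, h1.count _ hcn, Nat.cast_lt]
  refine (Ends.ite (T := w * 50 + 50) (fun hb => ?_) fun hb => ?_).mono ?_ fun _ => id
  · rw [hcond] at hb
    refine (Ends.seq (Ends.argmax (Easy v a · c) (fun j => -(D j : ℤ)) (by simp) (by simp) (by simp)
      h1.reg0 hnw (fun j _ s' hs' h6 => easyCond_holds h1.toHoldsCosts hs' h19 h6) ?_)
      (T' := 48) (fun s₂ hs₂ => ?_)).mono ?_ fun _ => id
    · intro j hj s' hs' h6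
      simp [Expr.eval, h6, (h1.agree hs').label j hj]
    swap
    · simp only [easyCond, Cond.cost, Expr.cost]
      omega
    obtain ⟨hs₂, hmax⟩ := hs₂
    have h2 := h1.agree hs₂
    have h29 : s₂.reg 9 = c := by rw [hs₂.2 9 (by simp) (by simp) (by simp), h19]
    have h210 : s₂.reg 10 = own c := by rw [hs₂.2 10 (by simp) (by simp) (by simp), h110]
    have hp2 := hp1.imp (s' := s₂) (hs₂.2 11 (by simp) (by simp) (by simp)) id
    obtain ⟨j, h7, hj, hez, hmin⟩ := hmax.resolve_left fun hcon =>
      hcon.2 _ hb.1 (hL.easy c hc hb.1)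
    refine (Ends.flat (by simp [Flat]) ?_).mono (show _ ≤ 48 by decide) fun _ => id
    have hcond2 : (Cond.lt (.read 4 (.var 7) (.const 0)) (.read 4 (.var 10) (.const 0))).holds s₂ ↔
        D j < D (own c) := by
      simp [Cond.holds, Expr.eval, h7, h210, h2.label j hj, h2.label _ hb.1]
    by_cases hlt : D j < D (own c)
    · obtain ⟨hL', hpot⟩ := hL.move hc hb.1 hj hez hlt hb.2
      have hne : own c ≠ j := fun h => by rw [h] at hlt; exact lt_irrefl _ hlt
      rw [exec, if_pos (hcond2.2 hlt)]
      refine ⟨by simp [exec, MemState.setReg, MemState.setTab, h29], _, D,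
        ⟨h2.toHoldsCosts.congr ?_ fun x hx => ?_, fun d hd => ?_, fun i hi => ?_, fun i hi => ?_⟩,
        hL', Or.inl ⟨?_, hpot.trans_le hp.le⟩⟩
      · simp [exec, MemState.setReg, MemState.setTab]
      · have : x ≠ 11 := by omega
        simp [exec, MemState.setReg, MemState.setTab, this]
      · rcases eq_or_ne d c with rfl | hdc
        · simp [exec, MemState.setTab, MemState.setReg, Expr.eval, h29, h7]
        · simp [exec, MemState.setTab, MemState.setReg, Expr.eval, h29, hdc, h2.owner d hd]
      · have h3 := cnt_update hc own j i
        have h4 := h2.count i hi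
        have h5 := h2.reg2
        by_cases hi1 : own c = i
        · subst hi1
          rw [if_pos rfl, if_neg hne.symm] at h3
          rw [add_zero] at h3
          rw [← h3] at h4
          simp only [exec, MemState.setTab, MemState.setReg, Expr.eval, h29, h7, h210, h5]
          simp only [Int.toNat_natCast, Int.toNat_zero]
          simp [hne, h4, mul_add]
        · rw [if_neg hi1, add_zero] at h3
          rw [h3]
          by_cases hi2 : j = i
          · subst hi2
            simp [exec, MemState.setTab, MemState.setReg, Expr.eval, h29, h7, h210, h5, h4,
              hne.symm, mul_add]
          · simp [exec, MemState.setTab, MemState.setReg, Expr.eval, h29, h7, h210, h5, h4,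
              Ne.symm hi1, Ne.symm hi2, hi2]
      · simp [exec, MemState.setTab, MemState.setReg, h2.label i hi]
      · simp [exec, MemState.setTab, MemState.setReg, Expr.eval]
    · rw [exec, if_neg (mt hcond2.1 hlt)]
      refine ⟨h29, own, D, h2, hL, hp2.imp rfl (hsucc fun _ _ i hi hi' => ?_)⟩
      have : -(D i : ℤ) ≤ -(D j : ℤ) := hmin i hi hi'
      omega
  · rw [hcond] at hb
    refine (Ends.flat (p := .skip) trivial ?_).mono (by simp only [flatCost]; omega) fun _ => id
    exact ⟨h19, own, D, h1, hL, hp1.imp rfl (hsucc fun h3 h4 => absurd ⟨h3, h4⟩ hb)⟩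
  · simp only [Cond.cost, Expr.cost]
    omega

theorem ends_raiseStep {i p : ℕ} (hi : i < n) {s : MemState}
    (h : HoldsLabels n m v a b m own D s) (hL : IsLabelling n m (Easy v a) own D) (h9 : s.reg 9 = i)
    (hstuck : ∀ c < m, i ≤ own c → Stuck n m v a own D c)
    (hp : Progress n m own D p (∀ j < i, (n + 1) * cnt m own j ≤ D j) s) :
    Ends raiseStep s 40 (fun s' => s'.reg 9 = i ∧ ∃ D,
      HoldsLabels n m v a b m own D s' ∧ IsLabelling n m (Easy v a) own D ∧
        (∀ c < m, i + 1 ≤ own c → Stuck n m v a own D c) ∧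
        Progress n m own D p (∀ j < i + 1, (n + 1) * cnt m own j ≤ D j) s') := by
  refine (Ends.flat (by simp [Flat, raiseStep]) ?_).mono (show _ ≤ 40 by decide) fun _ => id
  have hcond : (Cond.lt (.read 4 (.var 9) (.const 0)) (.read 3 (.var 9) (.const 0))).holds s ↔
      D i < (n + 1) * cnt m own i := by
    simp only [Cond.holds, Expr.eval, h9, Int.toNat_natCast, Int.toNat_zero]
    rw [h.label i hi, h.count i hi, Nat.cast_lt]
  by_cases hlt : D i < (n + 1) * cnt m own i
  · rw [raiseStep, exec, if_pos (hcond.2 hlt)]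
    obtain ⟨hL', hpot⟩ := hL.raise hi hlt fun c hc hci j hj hez => by
      subst hci
      exact hstuck c hc le_rfl hi hlt j hj hez
    refine ⟨by simp [exec, MemState.setReg, MemState.setTab, h9], _,
      ⟨h.toHoldsCosts.congr ?_ fun x hx => ?_, fun d hd => ?_, fun j hj => ?_, fun j hj => ?_⟩, hL',
      fun c hc hci hcn hlow j hj hez => ?_, Or.inl ⟨?_, hpot.trans_le hp.le⟩⟩
    · simp [exec, MemState.setReg, MemState.setTab]
    · have : x ≠ 11 := by omega
      simp [exec, MemState.setReg, MemState.setTab, this]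
    · simp [exec, MemState.setReg, MemState.setTab, h.owner d hd]
    · simp only [exec, MemState.setReg, MemState.setTab]
      simpa using h.count j hj
    · rcases eq_or_ne j i with rfl | hji
      · simp [exec, MemState.setReg, MemState.setTab, Expr.eval, h9, h.label j hj]
      · simp [exec, MemState.setReg, MemState.setTab, Expr.eval, h9, h.label j hj, hji]
    · rw [Function.update_of_ne (by omega)] at hlow ⊢
      refine (hstuck c hc (by omega) hcn hlow j hj hez).trans ?_
      rcases eq_or_ne j i with rfl | hji
      · simp
      · simp [hji]
    · simp [exec, MemState.setReg, MemState.setTab, Expr.eval]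
  · rw [raiseStep, exec, if_neg (mt hcond.1 hlt)]
    refine ⟨h9, D, h, hL, fun c hc hci => hstuck c hc (by omega), hp.imp rfl fun hP j hj => ?_⟩
    rcases Nat.lt_succ_iff_lt_or_eq.1 hj with hj | rfl
    · exact hP j hj
    · exact not_lt.1 hlt

theorem ends_balanceLabels {w : ℕ} (hnw : n < w) (hmw : m < w) {s : MemState}
    (h : HoldsLabels n m v a b m own (fun _ => 0) s)
    (hL : IsLabelling n m (Easy v a) own (fun _ => 0)) :
    Ends balanceLabels s (balanceLabelsTime w) (fun s' => ∃ own D,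
      HoldsLabels n m v a b m own D s' ∧ IsLabelling n m (Easy v a) own D ∧
        ∀ i < n, (n + 1) * cnt m own i ≤ D i) := by
  have hpot : potential n m own (fun _ => 0) ≤ w ^ 4 := by
    have h1 : potential n m own (fun _ => 0) = (m + 1) * (n * ((n + 1) * m)) := by
      simp [potential]
    rw [h1]
    calc (m + 1) * (n * ((n + 1) * m)) ≤ w * (w * (w * w)) := by gcongr <;> omega
      _ = w ^ 4 := by ring
  refine (Ends.seq (P := fun s' => s' = s.setReg 11 1) ⟨_, _, .assign _ _ _, le_rfl, rfl⟩
    (T' := (w ^ 4 + 2) * (roundTime w + 4)) ?_).mono (by simp [balanceLabelsTime, Expr.cost])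
    fun _ => id
  rintro _ rfl
  refine (Ends.while (T := roundTime w) (k := potential n m own (fun _ => 0) + 1)
    (fun k s' => ∃ own D,
      HoldsLabels n m v a b m own D s' ∧ IsLabelling n m (Easy v a) own D ∧
        (s'.reg 11 = 1 ∧ potential n m own D < k ∨
          s'.reg 11 = 0 ∧ ∀ i < n, (n + 1) * cnt m own i ≤ D i)) ?_
    ⟨own, _, h.setReg (by omega), hL, Or.inl ⟨by simp [MemState.setReg], Nat.lt_succ_self _⟩⟩).mono
      ?_ ?_
  · rintro k s₁ ⟨own, D, h, hL, hk⟩ hb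
    replace hk : s₁.reg 11 = 1 ∧ potential n m own D < k := by
      refine hk.resolve_right fun h' => ?_
      simp [Cond.holds, Expr.eval, h'.1] at hb
    refine Ends.seq (P := fun s' => s' = s₁.setReg 11 0) ⟨_, _, .assign _ _ _, le_rfl, rfl⟩ ?_
    rintro _ rfl
    set p := potential n m own D with hp
    refine Ends.seq (Ends.forLoop (k := m) (fun c s' => ∃ own D,
      HoldsLabels n m v a b m own D s' ∧ IsLabelling n m (Easy v a) own D ∧
        Progress n m own D p (∀ d < c, Stuck n m v a own D d) s') hmw ?_ ?_ ?_) ?_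
    · rintro j s' ⟨own, D, h, -⟩
      exact h.reg1
    · rintro c hc s' ⟨own, D, h, hL, hpr⟩ h9
      refine (ends_moveStep hnw hc h hL h9 hpr).mono le_rfl ?_
      rintro s'' ⟨h1, own, D, h2, h3, h4⟩
      exact ⟨h1, own, D, h2.setReg (by omega), h3, h4.imp (by simp [MemState.setReg]) id⟩
    · exact ⟨own, D, (h.setReg (by omega)).setReg (by omega), hL,
        Or.inr ⟨by simp [MemState.setReg], le_rfl, by simp⟩⟩
    rintro s₂ ⟨own, D, h, hL, hpr⟩
    refine (Ends.ite (T := w * (40 + 10)) (fun hb => ?_) fun hb => ?_).mono ?_ fun _ => id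
    · replace hpr : s₂.reg 11 = 0 ∧ potential n m own D ≤ p ∧ ∀ d < m, Stuck n m v a own D d := by
        refine hpr.resolve_left fun h' => ?_
        simp [Cond.holds, Expr.eval, h'.1] at hb
      refine (Ends.forLoop (k := n) (fun i s' => ∃ D,
        HoldsLabels n m v a b m own D s' ∧ IsLabelling n m (Easy v a) own D ∧
          (∀ c < m, i ≤ own c → Stuck n m v a own D c) ∧
          Progress n m own D p (∀ j < i, (n + 1) * cnt m own j ≤ D j) s') hnw ?_ ?_ ?_).mono
          le_rfl ?_
      · rintro j s' ⟨D, h, -⟩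
        exact h.reg0
      · rintro i hi s' ⟨D, h, hL, hst, hpr⟩ h9
        refine (ends_raiseStep hi h hL h9 hst hpr).mono le_rfl ?_
        rintro s'' ⟨h1, D, h2, h3, h4, h5⟩
        exact ⟨h1, D, h2.setReg (by omega), h3, h4, h5.imp (by simp [MemState.setReg]) id⟩
      · exact ⟨D, h.setReg (by omega), hL, fun c hc _ => hpr.2.2 c hc,
          Or.inr ⟨by simp [MemState.setReg, hpr.1], hpr.2.1, by simp⟩⟩
      · rintro s₃ ⟨D, h, hL, -, hpr⟩
        rcases hpr with ⟨h1, h2⟩ | ⟨h1, h2, h3⟩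
        · exact ⟨p, hk.2, own, D, h, hL, Or.inl ⟨h1, h2⟩⟩
        · exact ⟨p, hk.2, own, D, h, hL, Or.inr ⟨h1, h3⟩⟩
    · refine (Ends.flat (p := .skip) trivial ?_).mono ?_ fun _ => id
      · rcases hpr with hpr | hpr
        · exact ⟨p, hk.2, own, D, h, hL, Or.inl hpr⟩
        · simp [Cond.holds, Expr.eval, hpr.1] at hb
      · simp only [flatCost]
        omega
    · simp only [Cond.cost, Expr.cost]
      omega
  · simp only [Cond.cost, Expr.cost]
    calc _ ≤ (w ^ 4 + 2) * (1 + 1 + 1 + roundTime w + 1) :=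
          Nat.mul_le_mul_right _ (by omega)
      _ = _ := by ring
  · rintro s' ⟨k, ⟨own, D, h, hL, hk⟩, hb⟩
    refine ⟨own, D, h, hL, ?_⟩
    rcases hk with hk | hk
    · simp [Cond.holds, Expr.eval, hk.1] at hb
    · exact hk.2

end Balancing

/-! ### Transfers on the machine -/

section Search

variable {n m : ℕ} {v : ℕ → ℕ → ℤ} {a b : ℤ} {own D : ℕ → ℕ} {θ : ℕ} {A : ℕ → ℕ}

/-- Register `5` holds the threshold, table `1` holds the assignment and table `5` the loads. -/
structure HoldsLoads (n m : ℕ) (v : ℕ → ℕ → ℤ) (a b : ℤ) (own D : ℕ → ℕ) (θ : ℕ) (A : ℕ → ℕ)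
    (s : MemState) : Prop extends HoldsLabels n m v a b m own D s where
  reg5 : s.reg 5 = θ
  assigned : ∀ c < m, s.tab 1 c 0 = A c
  loads : ∀ i < n, s.tab 5 i 0 = load n m own D a b θ A i

theorem HoldsLoads.congr {s s' : MemState} (h : HoldsLoads n m v a b own D θ A s)
    (ht : s'.tab = s.tab) (hr : ∀ x < 6, s'.reg x = s.reg x) :
    HoldsLoads n m v a b own D θ A s' :=
  ⟨h.toHoldsLabels.congr (fun _ _ => by rw [ht]) fun x hx => hr x (by omega),
    by rw [hr 5 (by omega), h.reg5], fun c hc => by rw [ht, h.assigned c hc],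
    fun i hi => by rw [ht, h.loads i hi]⟩

theorem HoldsLoads.agree {s s' : MemState} (h : HoldsLoads n m v a b own D θ A s)
    (hs : Agree s s') : HoldsLoads n m v a b own D θ A s' :=
  h.congr hs.1 fun _ hx => hs.reg_of_lt hx

theorem HoldsLoads.setReg {s : MemState} (h : HoldsLoads n m v a b own D θ A s) {x : ℕ} {z : ℤ}
    (hx : 6 ≤ x) : HoldsLoads n m v a b own D θ A (s.setReg x z) :=
  h.congr rfl fun _ hy => setReg_of_lt hx hy

/-- The assignment becomes `own`, and the loads become the prices of the owned bundles. -/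
def initLoads : Prog :=
  .seq (forLoop 9 0 (.write 5 (.var 9) (.const 0) (.const 0)))
    (forLoop 9 1 (.seq (.assign 10 (.read 2 (.var 9) (.const 0)))
      (.seq (.write 1 (.var 9) (.const 0) (.var 10))
        (.ite (.and (.lt (.var 10) (.var 0)) (.lt (.read 4 (.var 10) (.const 0)) (.var 5)))
          (.write 5 (.var 10) (.const 0) (.add (.read 5 (.var 10) (.const 0)) (.var 4)))
          (.write 5 (.var 10) (.const 0) (.add (.read 5 (.var 10) (.const 0)) (.var 3)))))))

def initLoadsTime {R : Type*} [Semiring R] (w : R) : R := w * (4 + 10) + w * (50 + 10)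

theorem exec_seq (p q : Prog) (s : MemState) : exec (.seq p q) s = exec q (exec p s) := rfl

theorem load_succ (k : ℕ) (A : ℕ → ℕ) (i : ℕ) : load n (k + 1) own D a b θ A i =
    load n k own D a b θ A i + if A k = i then price n own D a b θ k else 0 := by
  rw [load, load, sum_range_succ]

theorem ends_initLoads {w : ℕ} (hnw : n < w) (hmw : m < w) {s : MemState}
    (h : HoldsLabels n m v a b m own D s) (h5 : s.reg 5 = θ) :
    Ends initLoads s (initLoadsTime w)
      (fun s' => HoldsLoads n m v a b own D θ own s' ∧ s'.reg 12 = s.reg 12) := by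
  refine Ends.seq (Ends.forLoop (k := n) (fun k s' => HoldsLabels n m v a b m own D s' ∧
    s'.reg 5 = θ ∧ s'.reg 12 = s.reg 12 ∧ ∀ i < k, s'.tab 5 i 0 = 0) hnw ?_ ?_ ?_) ?_
  · rintro j s' ⟨h, -⟩
    exact h.reg0
  · rintro i hi s' ⟨h, h5, h12, h0⟩ h9
    refine ⟨_, _, .write _ _ _ _ _, by simp [Expr.cost], by simpa [MemState.setTab] using h9,
      HoldsLabels.setReg (h.congr ?_ ?_) (by omega), ?_, ?_, ?_⟩
    · rintro x (rfl | rfl | rfl | rfl) <;> simp [MemState.setTab]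
    · simp [MemState.setTab]
    · simpa [MemState.setTab, MemState.setReg] using h5
    · simpa [MemState.setTab, MemState.setReg] using h12
    · intro j hj
      by_cases hji : j = i
      · simp [MemState.setTab, MemState.setReg, Expr.eval, h9, hji]
      · simpa [MemState.setTab, MemState.setReg, Expr.eval, h9, hji] using h0 j (by omega)
  · exact ⟨h.setReg (by omega), by simpa [MemState.setReg] using h5, by simp [MemState.setReg],
      by simp⟩
  rintro s₁ ⟨h, h5, h12, h0⟩
  refine (Ends.forLoop (k := m) (fun k s' => HoldsLabels n m v a b m own D s' ∧
    s'.reg 5 = θ ∧ s'.reg 12 = s.reg 12 ∧ (∀ c < k, s'.tab 1 c 0 = own c) ∧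
      ∀ i < n, s'.tab 5 i 0 = load n k own D a b θ own i) hmw ?_ ?_ ?_).mono le_rfl ?_
  · rintro j s' ⟨h, -⟩
    exact h.reg1
  · rintro c hc s' ⟨h, h5, h12, h1, h2⟩ h9
    refine (Ends.flat (by simp [Flat]) ?_).mono (show _ ≤ 50 by decide) fun _ => id
    have hown := h.owner c hc
    set s₂ := (s'.setReg 10 (own c)).setTab 1 c 0 (own c) with hs₂
    have hs₂' : exec (.write 1 (.var 9) (.const 0) (.var 10))
        (exec (.assign 10 (.read 2 (.var 9) (.const 0))) s') = s₂ := by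
      simp [exec, Expr.eval, h9, hown, hs₂, MemState.setReg]
    have hcond : (Cond.and (.lt (.var 10) (.var 0))
        (.lt (.read 4 (.var 10) (.const 0)) (.var 5))).holds s₂ ↔ Cheap n own D θ c := by
      have e0 : s₂.reg 0 = n := by simp [hs₂, MemState.setTab, MemState.setReg, h.reg0]
      have e5 : s₂.reg 5 = θ := by simp [hs₂, MemState.setTab, MemState.setReg, h5]
      have e10 : s₂.reg 10 = own c := by simp [hs₂, MemState.setTab, MemState.setReg]
      have e4 : s₂.tab 4 (own c) 0 = s'.tab 4 (own c) 0 := by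
        simp [hs₂, MemState.setTab, MemState.setReg]
      simp only [Cond.holds, Expr.eval, e0, e5, e10, Int.toNat_natCast, Int.toNat_zero, e4,
        Nat.cast_lt, Cheap]
      refine and_congr_right fun hcn => ?_
      rw [h.label _ hcn, Nat.cast_lt]
    have hexec : exec (.ite (.and (.lt (.var 10) (.var 0))
          (.lt (.read 4 (.var 10) (.const 0)) (.var 5)))
          (.write 5 (.var 10) (.const 0) (.add (.read 5 (.var 10) (.const 0)) (.var 4)))
          (.write 5 (.var 10) (.const 0) (.add (.read 5 (.var 10) (.const 0)) (.var 3)))) s₂ =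
        s₂.setTab 5 (own c) 0 (s'.tab 5 (own c) 0 + price n own D a b θ c) := by
      rw [exec]
      by_cases hch : Cheap n own D θ c
      · rw [if_pos (hcond.2 hch)]
        simp [exec, Expr.eval, hs₂, MemState.setTab, MemState.setReg, price, hch, h.reg4]
      · rw [if_neg (mt hcond.1 hch)]
        simp [exec, Expr.eval, hs₂, MemState.setTab, MemState.setReg, price, hch, h.reg3]
    rw [exec_seq, exec_seq, hs₂', hexec, hs₂]
    refine ⟨by simpa [MemState.setTab, MemState.setReg] using h9,
      HoldsLabels.setReg (h.congr ?_ ?_) (by omega), ?_, ?_, ?_, ?_⟩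
    · rintro x (rfl | rfl | rfl | rfl) <;> simp [MemState.setTab, MemState.setReg]
    · intro x hx
      have : x ≠ 10 := by omega
      simp [MemState.setTab, MemState.setReg, this]
    · simpa [MemState.setTab, MemState.setReg] using h5
    · simpa [MemState.setTab, MemState.setReg] using h12
    · intro d hd
      by_cases hdc : d = c
      · simp [MemState.setTab, MemState.setReg, hdc]
      · simpa [MemState.setTab, MemState.setReg, hdc] using h1 d (by omega)
    · intro i hi
      rw [load_succ, ← h2 i hi]
      by_cases hic : i = own c
      · simp [MemState.setTab, MemState.setReg, hic]
      · simp [MemState.setTab, MemState.setReg, hic, Ne.symm hic]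
  · exact ⟨h.setReg (by omega), by simpa [MemState.setReg] using h5,
      by simpa [MemState.setReg] using h12, by simp, fun i hi => by
        simpa [MemState.setReg, load] using h0 i hi⟩
  · rintro s' ⟨h, h5, h12, h1, h2⟩
    exact ⟨⟨h, h5, h1, h2⟩, h12⟩

/-- The chore in register `9` goes to a lower agent of minimal load. If there are no lower agents,
register `13` is set. -/
def give : Prog :=
  .seq (argmax 0 (.lt (.read 4 (.var 6) (.const 0)) (.var 5))
      (.sub (.const 0) (.read 5 (.var 6) (.const 0))))
    (.ite (.lt (.var 7) (.var 0))
      (.seq (.assign 10 (.read 1 (.var 9) (.const 0)))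
        (.seq (.write 5 (.var 10) (.const 0) (.sub (.read 5 (.var 10) (.const 0)) (.var 3)))
          (.seq (.write 5 (.var 7) (.const 0) (.add (.read 5 (.var 7) (.const 0)) (.var 3)))
            (.write 1 (.var 9) (.const 0) (.var 7)))))
      (.assign 13 (.const 1)))

def giveTime {R : Type*} [Semiring R] (w : R) : R := w * 40 + 60

theorem ends_give {w c : ℕ} (hb : 0 < b) (hnw : n < w) {s : MemState}
    (h : HoldsLoads n m v a b own D θ A s) (hA : IsAssignment n m own D a b θ A) (hc : c < m)
    (h9 : s.reg 9 = c)
    (hfrom : n ≤ A c ∨ A c ∈ upper n D θ ∧ ∀ j ∈ upper n D θ,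
      load n m own D a b θ A j ≤ load n m own D a b θ A (A c)) :
    Ends give s (giveTime w) (fun s' => s'.reg 9 = c ∧ s'.reg 12 = s.reg 12 ∧
      ((∃ k ∈ lower n D θ, s'.reg 13 = s.reg 13 ∧
          HoldsLoads n m v a b own D θ (Function.update A c k) s' ∧
          IsAssignment n m own D a b θ (Function.update A c k)) ∨
        (lower n D θ = ∅ ∧ s'.reg 13 = 1 ∧ HoldsLoads n m v a b own D θ A s'))) := by
  refine (Ends.seq (Ends.argmax (fun j => D j < θ) (fun j => -load n m own D a b θ A j) (by simp)
      (by simp) (by simp) h.reg0 hnw ?_ ?_) (T' := 50) (fun s₂ hs₂ => ?_)).mono ?_ fun _ => id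
  · intro j hj s' hs' h6
    have := h.agree hs'
    simp [Cond.holds, Expr.eval, h6, this.label j hj, this.reg5]
  · intro j hj s' hs' h6
    have := h.agree hs'
    simp [Expr.eval, h6, this.loads j hj]
  swap
  · simp only [giveTime, Cond.cost, Expr.cost]
    omega
  obtain ⟨hs₂, hmax⟩ := hs₂
  have h2 := h.agree hs₂
  have h29 : s₂.reg 9 = c := by rw [hs₂.2 9 (by simp) (by simp) (by simp), h9]
  have h212 := hs₂.2 12 (by simp) (by simp) (by simp)
  have h213 := hs₂.2 13 (by simp) (by simp) (by simp)
  refine (Ends.flat (by simp [Flat]) ?_).mono (show _ ≤ 50 by decide) fun _ => id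
  rcases hmax with ⟨h7, hemp⟩ | ⟨k, h7, hkn, hkD, hmin⟩
  · rw [exec, if_neg (by simp [Cond.holds, Expr.eval, h7, h2.reg0])]
    refine ⟨by simpa [exec, MemState.setReg] using h29, by simpa [exec, MemState.setReg] using h212,
      Or.inr ⟨?_, by simp [exec, MemState.setReg, Expr.eval], h2.setReg (by omega)⟩⟩
    exact eq_empty_of_forall_notMem fun k hk => hemp k (mem_lower.1 hk).1 (mem_lower.1 hk).2
  · have hk : k ∈ lower n D θ := mem_lower.2 ⟨hkn, hkD⟩
    rw [exec, if_pos (by simpa [Cond.holds, Expr.eval, h7, h2.reg0] using hkn)]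
    have hAc := h2.assigned c hc
    refine ⟨by simpa [exec, MemState.setReg, MemState.setTab] using h29,
      by simpa [exec, MemState.setReg, MemState.setTab] using h212, Or.inl ⟨k, hk,
      by simpa [exec, MemState.setReg, MemState.setTab] using h213,
      ⟨h2.toHoldsLabels.congr ?_ ?_, ?_, ?_, ?_⟩, hA.give hb hc hfrom hk fun l hl => ?_⟩⟩
    · rintro x (rfl | rfl | rfl | rfl) <;> simp [exec, MemState.setTab, MemState.setReg]
    · intro x hx
      have : x ≠ 10 := by omega
      simp [exec, MemState.setTab, MemState.setReg, this]
    · simpa [exec, MemState.setReg, MemState.setTab] using h2.reg5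
    · intro d hd
      by_cases hdc : d = c
      · simp [exec, MemState.setTab, MemState.setReg, Expr.eval, h29, h7, hdc]
      · simp [exec, MemState.setTab, MemState.setReg, Expr.eval, h29, hdc, h2.assigned d hd]
    · intro i hi
      have hexp : ¬ Cheap n own D θ c := by
        rintro ⟨h3, h4⟩
        have h5 := hA.cheap c hc ⟨h3, h4⟩
        rcases hfrom with h6 | ⟨h6, -⟩
        · omega
        · rw [mem_upper, h5] at h6
          omega
      have hload := load_update (n := n) (own := own) (D := D) (a := a) (b := b) (θ := θ) (A := A)
        hc k i
      rw [show price n own D a b θ c = b from if_neg hexp] at hload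
      have h3 := h2.loads i hi
      have hkA : k ≠ A c := by
        rintro rfl
        rcases hfrom with h6 | ⟨h6, -⟩
        · omega
        · rw [mem_upper] at h6
          omega
      simp only [exec, MemState.setTab, MemState.setReg, Expr.eval, h29, h7]
      by_cases hiA : i = A c
      · subst hiA
        rw [if_pos rfl, if_neg hkA] at hload
        simp [hkA.symm, h3, h2.reg3, hAc]
        linarith
      · rw [if_neg (Ne.symm hiA)] at hload
        by_cases hik : i = k
        · subst hik
          rw [if_pos rfl] at hload
          simp [hkA, h3, h2.reg3, hAc]
          linarith
        · rw [if_neg (Ne.symm hik)] at hload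
          simp [hik, hiA, h3, hAc]
          linarith
    · have : -load n m own D a b θ A l ≤ -load n m own D a b θ A k :=
        hmin l (mem_lower.1 hl).1 (mem_lower.1 hl).2
      linarith

/-- The chores that nobody finds easy are given to lower agents. -/
def giveHard : Prog :=
  .seq (.assign 13 (.const 0)) (forLoop 9 1
    (.ite (.lt (.read 1 (.var 9) (.const 0)) (.var 0)) .skip give))

def giveHardTime {R : Type*} [Semiring R] (w : R) : R := 2 + w * (giveTime w + 10 + 10)

theorem ends_giveHard {w : ℕ} (hb : 0 < b) (hnw : n < w) (hmw : m < w) {s : MemState}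
    (h : HoldsLoads n m v a b own D θ own s) :
    Ends giveHard s (giveHardTime w) (fun s' => s'.reg 12 = s.reg 12 ∧
      ∃ A, HoldsLoads n m v a b own D θ A s' ∧
      (s'.reg 13 = 0 ∧ IsAssignment n m own D a b θ A ∧ (∀ c < m, A c < n) ∧ moved n m own A = 0 ∨
        s'.reg 13 = 1 ∧ lower n D θ = ∅ ∧ ∃ c < m, n ≤ own c)) := by
  refine Ends.seq (P := fun s' => s' = s.setReg 13 0) ⟨_, _, .assign _ _ _, le_rfl, rfl⟩ ?_
  rintro _ rfl
  refine (Ends.forLoop (k := m) (fun k s' => s'.reg 12 = s.reg 12 ∧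
    ∃ A, HoldsLoads n m v a b own D θ A s' ∧ IsAssignment n m own D a b θ A ∧ moved n m own A = 0 ∧
      (s'.reg 13 = 0 ∧ (∀ c < k, A c < n) ∨
        s'.reg 13 = 1 ∧ lower n D θ = ∅ ∧ ∃ c < m, n ≤ own c)) hmw ?_ ?_ ?_).mono le_rfl ?_
  · rintro j s' ⟨-, A, h, -⟩
    exact h.reg1
  · rintro c hc s₁ ⟨h12, A, h, hA, hmv, hst⟩ h9
    have hcond : (Cond.lt (.read 1 (.var 9) (.const 0)) (.var 0)).holds s₁ ↔ A c < n := by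
      simp [Cond.holds, Expr.eval, h9, h.assigned c hc, h.reg0]
    refine (Ends.ite (T := giveTime w) (fun hlt => ?_) fun hlt => ?_).mono
      (by simp only [Cond.cost, Expr.cost]; omega) fun _ => id
    · rw [hcond] at hlt
      refine (Ends.flat (p := .skip) trivial ?_).mono (by simp [flatCost, giveTime]) fun _ => id
      refine ⟨h9, by simpa [exec, MemState.setReg] using h12, A, h.setReg (by omega), hA, hmv, ?_⟩
      refine hst.imp (fun h => ⟨by simpa [exec, MemState.setReg] using h.1, fun d hd => ?_⟩)
        fun h => ⟨by simpa [exec, MemState.setReg] using h.1, h.2⟩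
      rcases Nat.lt_succ_iff_lt_or_eq.1 hd with hd | rfl
      · exact h.2 d hd
      · exact hlt
    · rw [hcond, not_lt] at hlt
      refine (ends_give hb hnw h hA hc h9 (Or.inl hlt)).mono le_rfl ?_
      rintro s₂ ⟨h29, h212, h2⟩
      refine ⟨h29, by simpa [MemState.setReg, h212] using h12, ?_⟩
      rcases h2 with ⟨k, hk, h213, h2, hA2⟩ | ⟨hemp, h213, h2⟩
      · have hk' := mem_lower.1 hk
        refine ⟨_, h2.setReg (by omega), hA2, ?_, ?_⟩
        · rw [moved_update hA hc hk'.1 hk'.2 (Or.inl hlt), if_neg (not_lt.2 hlt), hmv]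
        · rcases hst with ⟨h13, htot⟩ | ⟨-, hemp, -⟩
          · refine Or.inl ⟨by simpa [MemState.setReg, h213] using h13, fun d hd => ?_⟩
            rcases eq_or_ne d c with rfl | hdc
            · simpa using hk'.1
            · rw [Function.update_of_ne hdc]
              exact htot d (by omega)
          · rw [hemp] at hk
            simp at hk
      · refine ⟨A, h2.setReg (by omega), hA, hmv, Or.inr ⟨by simpa [MemState.setReg] using h213,
          hemp, c, hc, ?_⟩⟩
        rw [hA.unassigned c hc hlt]
        exact hlt
  · refine ⟨by simp [MemState.setReg], own, (h.setReg (by omega)).setReg (by omega),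
      isAssignment_own, moved_own, Or.inl ⟨by simp [MemState.setReg], by simp⟩⟩
  · rintro s' ⟨h12, A, h, hA, hmv, hst⟩
    exact ⟨h12, A, h, hst.imp_left fun h => ⟨h.1, hA, h.2, hmv⟩⟩

end Search

/-! ### Search for the threshold -/

section Thresholds

variable {n m : ℕ} {v : ℕ → ℕ → ℤ} {a b : ℤ} {own D : ℕ → ℕ} {θ : ℕ} {A : ℕ → ℕ}

/-- If two loads differ by more than `b`, an upper agent of maximal load gives up a chore; if there
is none, register `13` is set. Otherwise registers `12` and `13` are set. -/
def transferStep : Prog :=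
  .seq (argmax 0 (.eq (.const 0) (.const 0)) (.read 5 (.var 6) (.const 0)))
    (.seq (.assign 10 (.var 7))
      (.seq (argmax 0 (.eq (.const 0) (.const 0)) (.sub (.const 0) (.read 5 (.var 6) (.const 0))))
        (.ite (.lt (.add (.read 5 (.var 7) (.const 0)) (.var 3)) (.read 5 (.var 10) (.const 0)))
          (.seq (argmax 1 (.not (.lt (.read 4 (.read 1 (.var 6) (.const 0)) (.const 0)) (.var 5)))
              (.read 5 (.read 1 (.var 6) (.const 0)) (.const 0)))
            (.seq (.assign 9 (.var 7)) (.ite (.lt (.var 9) (.var 1)) give (.assign 13 (.const 1)))))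
          (.seq (.assign 12 (.const 1)) (.assign 13 (.const 1))))))

/-- Transfers are made until all loads differ by at most `b`, or no transfer is possible. -/
def transfers : Prog := .while (.eq (.var 13) (.const 0)) transferStep

def transferStepTime {R : Type*} [Semiring R] (w : R) : R := 3 * (w * 50 + 10) + giveTime w + 60

def transfersTime {R : Type*} [Semiring R] (w : R) : R := (w + 1) * (transferStepTime w + 4)

theorem load_nonneg (ha : 0 < a) (hab : a ≤ b) (i : ℕ) : 0 ≤ load n m own D a b θ A i := by
  refine sum_nonneg fun c _ => ?_
  rw [price]
  split_ifs <;> omega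

/-- The outcome of a series of transfers: it goes on after `moved n m own A` transfers that all led to
unbalanced loads, or a solution has been found, or the threshold is exhausted. -/
def Outcome (n m : ℕ) (a b : ℤ) (own D : ℕ → ℕ) (θ : ℕ) (A : ℕ → ℕ) (s : MemState) : Prop :=
  (s.reg 13 = 0 ∧ s.reg 12 = 0 ∧ IsAssignment n m own D a b θ A ∧ (∀ c < m, A c < n) ∧
      ∀ g < moved n m own A, Unbalanced n m own D a b θ g) ∨
    (s.reg 13 = 1 ∧ s.reg 12 = 1 ∧ IsSolution n m own D a b θ A) ∨
    (s.reg 13 = 1 ∧ s.reg 12 = 0 ∧ Exhausted n m own D a b θ)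

theorem ends_transferStep {w : ℕ} (hn : 0 < n) (ha : 0 < a) (hab : a ≤ b) (hnw : n < w)
    (hmw : m < w) (hgap : ∀ j < n, D j + 1 ≠ θ) (hpr : ∃ c < m, ¬ Cheap n own D θ c)
    {s : MemState} (h : HoldsLoads n m v a b own D θ A s) (h13 : s.reg 13 = 0) (h12 : s.reg 12 = 0)
    (hA : IsAssignment n m own D a b θ A) (htot : ∀ c < m, A c < n)
    (htried : ∀ g < moved n m own A, Unbalanced n m own D a b θ g) :
    Ends transferStep s (transferStepTime w) (fun s' => ∃ A',
      HoldsLoads n m v a b own D θ A' s' ∧ Outcome n m a b own D θ A' s' ∧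
        (s'.reg 13 = 0 → moved n m own A' = moved n m own A + 1)) := by
  have hb : 0 < b := ha.trans_le hab
  refine (Ends.seq (Ends.argmax (fun _ => True) (fun j => load n m own D a b θ A j) (by simp)
      (by simp) (by simp) h.reg0 hnw ?_ ?_)
      (T' := 2 + ((w * 50 + 10) + ((w * 50 + 10) + giveTime w + 40))) (fun s₁ hs₁ => ?_)).mono ?_
      fun _ => id
  · intro j _ s' _ _
    simp [Cond.holds]
  · intro j hj s' hs' h6
    simp [Expr.eval, h6, (h.agree hs').loads j hj]
  swap
  · simp only [transferStepTime, Cond.cost, Expr.cost]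
    omega
  obtain ⟨hs₁, hmax⟩ := hs₁
  obtain ⟨p, h17, hp, -, hpmax⟩ := hmax.resolve_left fun hcon => hcon.2 0 hn trivial
  have h1 := (h.agree hs₁).setReg (x := 10) (z := p) (by omega)
  refine Ends.seq (P := fun s' => s' = s₁.setReg 10 p)
    ⟨_, _, .assign _ _ _, le_rfl, by simp [Expr.eval, h17]⟩ ?_
  rintro _ rfl
  refine (Ends.seq (Ends.argmax (fun _ => True) (fun j => -load n m own D a b θ A j) (by simp)
      (by simp) (by simp) h1.reg0 hnw ?_ ?_)
      (T' := (w * 50 + 10) + giveTime w + 40) (fun s₂ hs₂ => ?_)).mono ?_ fun _ => id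
  · intro j _ s' _ _
    simp [Cond.holds]
  · intro j hj s' hs' h6
    simp [Expr.eval, h6, (h1.agree hs').loads j hj]
  swap
  · simp only [Cond.cost, Expr.cost]
    omega
  obtain ⟨hs₂, hmax⟩ := hs₂
  obtain ⟨q, h27, hq, -, hqmin⟩ := hmax.resolve_left fun hcon => hcon.2 0 hn trivial
  have h2 := h1.agree hs₂
  have h210 : s₂.reg 10 = p := by
    rw [hs₂.2 10 (by simp) (by simp) (by simp)]
    simp [MemState.setReg]
  have h213 : s₂.reg 13 = 0 := by
    rw [hs₂.2 13 (by simp) (by simp) (by simp)]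
    simp [MemState.setReg, hs₁.2 13, h13]
  have h212 : s₂.reg 12 = 0 := by
    rw [hs₂.2 12 (by simp) (by simp) (by simp)]
    simp [MemState.setReg, hs₁.2 12, h12]
  have hcond : (Cond.lt (.add (.read 5 (.var 7) (.const 0)) (.var 3))
      (.read 5 (.var 10) (.const 0))).holds s₂ ↔
      load n m own D a b θ A q + b < load n m own D a b θ A p := by
    simp [Cond.holds, Expr.eval, h27, h210, h2.loads p hp, h2.loads q hq, h2.reg3]
  refine (Ends.ite (T := (w * 50 + 10) + giveTime w + 26) (fun hlt => ?_) fun hlt => ?_).mono ?_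
    fun _ => id
  · rw [hcond] at hlt
    have hbad : ∀ g ≤ moved n m own A, Unbalanced n m own D a b θ g := fun g hg => by
      rcases hg.lt_or_eq with hg | rfl
      · exact htried g hg
      · exact ⟨A, hA, htot, rfl, p, hp, q, hq, hlt⟩
    refine (Ends.seq (Ends.argmax (fun c => θ ≤ D (A c)) (fun c => load n m own D a b θ A (A c))
      (by simp) (by simp) (by simp) h2.reg1 hmw ?_ ?_)
      (T' := giveTime w + 16) (fun s₃ hs₃ => ?_)).mono ?_ fun _ => id
    · intro c hc s' hs' h6
      have h' := h2.agree hs'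
      simp [Cond.holds, Expr.eval, h6, h'.assigned c hc, h'.label _ (htot c hc), h'.reg5]
    · intro c hc s' hs' h6
      have h' := h2.agree hs'
      simp [Expr.eval, h6, h'.assigned c hc, h'.loads _ (htot c hc)]
    swap
    · simp only [Cond.cost, Expr.cost]
      omega
    obtain ⟨hs₃, hmax⟩ := hs₃
    have h3 := h2.agree hs₃
    have h313 := (hs₃.2 13 (by simp) (by simp) (by simp)).trans h213
    have h312 := (hs₃.2 12 (by simp) (by simp) (by simp)).trans h212
    refine (Ends.seq (P := fun s' => s' = s₃.setReg 9 (s₃.reg 7)) (T' := giveTime w + 10)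
      ⟨_, _, .assign _ _ _, le_rfl, by simp [Expr.eval]⟩ ?_).mono (by simp only [Expr.cost]; omega)
      fun _ => id
    rintro _ rfl
    have h4 := h3.setReg (x := 9) (z := s₃.reg 7) (by omega)
    refine (Ends.ite (T := giveTime w + 2) (fun hcm => ?_) fun hcm => ?_).mono
      (by simp only [Cond.cost, Expr.cost]; omega) fun _ => id
    · obtain ⟨c, h37, hc, hcD, hcmax⟩ := hmax.resolve_left fun hcon => by
        have := h4.reg1
        simp only [Cond.holds, Expr.eval, this] at hcm
        simp [MemState.setReg, hcon.1] at hcm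
      have hcu : A c ∈ upper n D θ := mem_upper.2 ⟨htot c hc, hcD⟩
      refine (ends_give hb hnw h4 hA hc (by simp [MemState.setReg, h37])
        (Or.inr ⟨hcu, fun j hj => ?_⟩)).mono (by omega) ?_
      · by_cases hex : ∃ d < m, A d = j
        · obtain ⟨d, hd, rfl⟩ := hex
          exact hcmax d hd (mem_upper.1 hj).2
        · push Not at hex
          refine le_trans (le_of_eq ?_) (load_nonneg ha hab (A c))
          exact sum_eq_zero fun d hd => if_neg (hex d (mem_range.1 hd))
      · rintro s₅ ⟨-, h512, ⟨k, hk, h513, h5, hA5⟩ | ⟨hemp, h513, h5⟩⟩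
        · replace h512 : s₅.reg 12 = 0 := by simpa [MemState.setReg, h312] using h512
          replace h513 : s₅.reg 13 = 0 := by simpa [MemState.setReg, h313] using h513
          have hk' := mem_lower.1 hk
          have hmv := moved_update hA hc hk'.1 hk'.2 (Or.inr (mem_upper.1 hcu))
          rw [if_pos (htot c hc)] at hmv
          refine ⟨_, h5, Or.inl ⟨h513, h512, hA5, fun d hd => ?_, fun g hg => hbad g (by omega)⟩,
            fun _ => hmv⟩
          rcases eq_or_ne d c with rfl | hdc
          · simpa using hk'.1
          · rw [Function.update_of_ne hdc]
            exact htot d hd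
        · replace h512 : s₅.reg 12 = 0 := by simpa [MemState.setReg, h312] using h512
          refine ⟨A, h5, Or.inr (Or.inr ⟨h513, h512, fun _ _ g _ hlow => ?_⟩), fun h => by
            rw [h513] at h; exact absurd h one_ne_zero⟩
          rcases hlow with hlow | ⟨-, rfl⟩
          · rw [hemp] at hlow
            simp at hlow
          · exact hbad 0 (Nat.zero_le _)
    · have hnone := hmax.resolve_right fun ⟨c, h37, hc, _⟩ => hcm (by
        have := h4.reg1
        simp only [Cond.holds, Expr.eval, this]
        simpa [MemState.setReg, h37] using hc)
      have hmv : ∑ i ∈ upper n D θ, cnt m own i ≤ moved n m own A := by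
        by_contra! hcon
        obtain ⟨c, hc, hcu, -⟩ := hA.exists_max_upper hb htot hcon
        exact hnone.2 c hc (mem_upper.1 hcu).2
      refine (Ends.flat (p := .assign 13 (.const 1)) trivial ?_).mono
        (by simp only [flatCost, Expr.cost]; omega) fun _ => id
      refine ⟨A, h4.setReg (by omega), Or.inr (Or.inr ⟨?_, ?_, fun _ _ g hg _ =>
        hbad g (hg.trans hmv)⟩), fun h => ?_⟩
      · simp [exec, MemState.setReg, Expr.eval]
      · simp [exec, MemState.setReg, h312]
      · simp [exec, MemState.setReg, Expr.eval] at h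
  · rw [hcond, not_lt] at hlt
    refine (Ends.flat (by simp [Flat]) ?_).mono (T' := _) (show flatCost _ ≤ _ by
      simp only [flatCost, Expr.cost]; omega) fun _ => id
    refine ⟨A, (h2.setReg (by omega)).setReg (by omega), Or.inr (Or.inl ⟨?_, ?_,
      ⟨hA, htot, hgap, hpr, fun i hi j hj => ?_⟩⟩), fun h => ?_⟩
    · simp [exec, MemState.setReg, Expr.eval]
    · simp [exec, MemState.setReg, Expr.eval]
    · have h3 := hpmax i hi trivial
      have h4 : -load n m own D a b θ A j ≤ -load n m own D a b θ A q := hqmin j hj trivial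
      dsimp only at h3
      linarith
    · simp [exec, MemState.setReg, Expr.eval] at h
  · simp only [Cond.cost, Expr.cost]
    omega

theorem ends_transfers {w : ℕ} (hn : 0 < n) (ha : 0 < a) (hab : a ≤ b) (hnw : n < w)
    (hmw : m < w) (hgap : ∀ j < n, D j + 1 ≠ θ) (hpr : ∃ c < m, ¬ Cheap n own D θ c)
    {s : MemState} (h : HoldsLoads n m v a b own D θ A s) (ho : Outcome n m a b own D θ A s) :
    Ends transfers s (transfersTime w) (fun s' => ∃ A, HoldsLoads n m v a b own D θ A s' ∧
      (s'.reg 12 = 1 ∧ IsSolution n m own D a b θ A ∨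
        s'.reg 12 = 0 ∧ Exhausted n m own D a b θ)) := by
  have hb : 0 < b := ha.trans_le hab
  have hS : ∑ i ∈ upper n D θ, cnt m own i ≤ m := by
    have h1 := sum_card_filter_and (upper n D θ) m own (fun _ => True)
    simp only [and_true] at h1
    simp only [cnt]
    rw [h1]
    calc _ ≤ ∑ _c ∈ range m, 1 := sum_le_sum fun c _ => by split_ifs <;> simp
      _ = m := by simp
  refine (Ends.while (T := transferStepTime w) (k := m + 1 - moved n m own A) (fun k s' => ∃ A,
    HoldsLoads n m v a b own D θ A s' ∧ Outcome n m a b own D θ A s' ∧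
      (s'.reg 13 = 0 → k = m + 1 - moved n m own A)) ?_ ⟨A, h, ho, fun _ => rfl⟩).mono ?_ ?_
  · rintro k s₁ ⟨A, h, ho, hk⟩ hc
    have h13 : s₁.reg 13 = 0 := by simpa [Cond.holds, Expr.eval] using hc
    obtain ⟨-, h12, hA, htot, htried⟩ := ho.resolve_right fun hcon => by
      rcases hcon with hcon | hcon <;> simp [hcon.1] at h13
    have hmv : moved n m own A ≤ m := by
      have := (hA.isConfig hb htot).sum_upper
      omega
    refine (ends_transferStep hn ha hab hnw hmw hgap hpr h h13 h12 hA htot htried).mono le_rfl ?_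
    rintro s₂ ⟨A', h2, ho2, hmv2⟩
    have := hk h13
    by_cases h213 : s₂.reg 13 = 0
    · have := hmv2 h213
      exact ⟨m + 1 - moved n m own A', by omega, A', h2, ho2, fun _ => rfl⟩
    · exact ⟨0, by omega, A', h2, ho2, fun h => absurd h h213⟩
  · simp only [transfersTime, Cond.cost, Expr.cost]
    calc _ ≤ (w + 1) * (1 + 1 + 1 + transferStepTime w + 1) := Nat.mul_le_mul_right _ (by omega)
      _ = _ := by ring
  · rintro s' ⟨k, ⟨A, h, ho, -⟩, hc⟩
    have h13 : s'.reg 13 ≠ 0 := by simpa [Cond.holds, Expr.eval] using hc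
    rcases ho with ho | ho | ho
    · exact absurd ho.1 h13
    · exact ⟨A, h, Or.inl ho.2⟩
    · exact ⟨A, h, Or.inr ho.2⟩

/-- All numbers of transfers are tried for the threshold in register `5`, if no label precedes it
immediately and some chore has price `b`. -/
def tryThreshold : Prog :=
  .seq (argmax 0 (.eq (.add (.read 4 (.var 6) (.const 0)) (.const 1)) (.var 5)) (.const 0))
    (.ite (.eq (.var 7) (.var 0))
      (.seq (argmax 1 (.not (.and (.lt (.read 2 (.var 6) (.const 0)) (.var 0))
          (.lt (.read 4 (.read 2 (.var 6) (.const 0)) (.const 0)) (.var 5)))) (.const 0))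
        (.ite (.lt (.var 7) (.var 1)) (.seq initLoads (.seq giveHard transfers)) .skip))
      .skip)

def tryThresholdTime {R : Type*} [Semiring R] (w : R) : R :=
  2 * (w * 50 + 20) + (initLoadsTime w + (giveHardTime w + transfersTime w))

theorem ends_tryThreshold {w : ℕ} (hn : 0 < n) (ha : 0 < a) (hab : a ≤ b) (hnw : n < w)
    (hmw : m < w) {s : MemState} (h : HoldsLabels n m v a b m own D s) (h5 : s.reg 5 = θ)
    (h12 : s.reg 12 = 0) :
    Ends tryThreshold s (tryThresholdTime w) (fun s' => HoldsLabels n m v a b m own D s' ∧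
      s'.reg 5 = θ ∧
      (s'.reg 12 = 1 ∧ (∃ A, IsSolution n m own D a b θ A ∧ ∀ c < m, s'.tab 1 c 0 = A c) ∨
        s'.reg 12 = 0 ∧ Exhausted n m own D a b θ)) := by
  refine (Ends.seq (Ends.argmax (fun j => D j + 1 = θ) (fun _ => 0) (by simp) (by simp) (by simp)
    h.reg0 hnw ?_ (fun _ _ _ _ _ => rfl))
    (T' := w * 50 + 30 + (initLoadsTime w + (giveHardTime w + transfersTime w)))
    (fun s₁ hs₁ => ?_)).mono ?_ fun _ => id
  · intro j hj s' hs' h6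
    simp only [Cond.holds, Expr.eval, h6, Int.toNat_natCast, Int.toNat_zero,
      (h.agree hs').label j hj, hs'.reg_of_lt (show 5 < 6 by omega), h5]
    norm_cast
  swap
  · simp only [tryThresholdTime, Cond.cost, Expr.cost]
    omega
  obtain ⟨hs₁, hgap⟩ := hs₁
  have h1 := h.agree hs₁
  have h15 := (hs₁.reg_of_lt (show 5 < 6 by omega)).trans h5
  have h112 := (hs₁.2 12 (by simp) (by simp) (by simp)).trans h12
  refine (Ends.ite (T := w * 50 + 25 + (initLoadsTime w + (giveHardTime w + transfersTime w)))
    (fun hc => ?_) fun hc => ?_).mono (by simp only [Cond.cost, Expr.cost]; omega) fun _ => id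
  · replace hgap := (hgap.resolve_right fun ⟨j, h7, hj, _⟩ => by
      simp [Cond.holds, Expr.eval, h7, h1.reg0, hj.ne] at hc).2
    refine (Ends.seq (Ends.argmax (fun c => ¬ Cheap n own D θ c) (fun _ => 0) (by simp) (by simp)
      (by simp) h1.reg1 hmw ?_ (fun _ _ _ _ _ => rfl))
      (T' := 5 + (initLoadsTime w + (giveHardTime w + transfersTime w)))
      (fun s₂ hs₂ => ?_)).mono ?_ fun _ => id
    · intro c hc s' hs' h6
      have h' := h1.agree hs'
      simp only [Cond.holds, Expr.eval, h6, Int.toNat_natCast, Int.toNat_zero, h'.owner c hc,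
        h'.reg0, Nat.cast_lt, hs'.reg_of_lt (show 5 < 6 by omega), h15, Cheap]
      refine not_congr (and_congr_right fun hcn => ?_)
      rw [h'.label _ hcn, Nat.cast_lt]
    swap
    · simp only [Cond.cost, Expr.cost]
      omega
    obtain ⟨hs₂, hpr⟩ := hs₂
    have h2 := h1.agree hs₂
    have h25 := (hs₂.reg_of_lt (show 5 < 6 by omega)).trans h15
    have h212 := (hs₂.2 12 (by simp) (by simp) (by simp)).trans h112
    refine (Ends.ite (T := initLoadsTime w + (giveHardTime w + transfersTime w))
      (fun hc => ?_) fun hc => ?_).mono (by simp only [Cond.cost, Expr.cost]; omega) fun _ => id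
    · obtain ⟨c, -, hcm, hch, -⟩ := hpr.resolve_left fun hcon => by
        simp [Cond.holds, Expr.eval, hcon.1, h2.reg1] at hc
      have hpr' : ∃ c < m, ¬ Cheap n own D θ c := ⟨c, hcm, hch⟩
      refine Ends.seq (ends_initLoads hnw hmw h2 h25) ?_
      rintro s₃ ⟨h3, h312⟩
      refine Ends.seq (ends_giveHard (ha.trans_le hab) hnw hmw h3) ?_
      rintro s₄ ⟨h412, A, h4, hst⟩
      have h412' : s₄.reg 12 = 0 := by rw [h412, h312, h212]
      refine (ends_transfers hn ha hab hnw hmw hgap hpr' h4 ?_).mono le_rfl ?_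
      · rcases hst with ⟨h13, hA, htot, hmv⟩ | ⟨h13, hemp, d, hd, hdn⟩
        · exact Or.inl ⟨h13, h412', hA, htot, by simp [hmv]⟩
        · refine Or.inr (Or.inr ⟨h13, h412', fun _ _ g _ hlow => ?_⟩)
          rcases hlow with hlow | ⟨hlow, -⟩
          · rw [hemp] at hlow
            simp at hlow
          · exact absurd (hlow d hd) (not_lt.2 hdn)
      · rintro s₅ ⟨A, h5, hst⟩
        exact ⟨h5.toHoldsLabels, h5.reg5, hst.imp_left fun h => ⟨h.1, A, h.2, h5.assigned⟩⟩
    · refine (Ends.flat (p := .skip) trivial ?_).mono ?_ fun _ => id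
      · refine ⟨h2, h25, Or.inr ⟨h212, fun _ hpr' => ?_⟩⟩
        obtain ⟨c, hcm, hch⟩ := hpr'
        rcases hpr with hpr | ⟨d, h7, hd, -⟩
        · exact absurd hch (hpr.2 c hcm)
        · exact absurd (by simpa [Cond.holds, Expr.eval, h7, h2.reg1] using hd) hc
      · simp only [flatCost, giveHardTime]
        omega
  · refine (Ends.flat (p := .skip) trivial ?_).mono (by simp only [flatCost]; omega) fun _ => id
    refine ⟨h1, h15, Or.inr ⟨h112, fun hgap' => ?_⟩⟩
    rcases hgap with hgap | ⟨j, -, hj, hjθ, -⟩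
    · exact absurd (by simp [Cond.holds, Expr.eval, hgap.1, h1.reg0]) hc
    · exact absurd hjθ (hgap' j hj)

/-- Thresholds are tried in increasing order until a solution is found. -/
def searchThreshold : Prog :=
  .seq (.seq (.assign 5 (.const 0)) (.assign 12 (.const 0)))
    (.while (.eq (.var 12) (.const 0))
      (.seq tryThreshold (.assign 5 (.add (.var 5) (.const 1)))))

def searchThresholdTime {R : Type*} [Semiring R] (w : R) : R :=
  4 + (w ^ 2 + 4) * (tryThresholdTime w + 8)

theorem ends_searchThreshold {ez : ℕ → ℕ → Prop} {w : ℕ} (hn : 0 < n) (hm : 0 < m) (ha : 0 < a)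
    (hab : a ≤ b) (hnw : n < w) (hmw : m < w) {s : MemState}
    (h : HoldsLabels n m v a b m own D s) (hL : IsLabelling n m ez own D)
    (hfin : ∀ i < n, (n + 1) * cnt m own i ≤ D i) :
    Ends searchThreshold s (searchThresholdTime w) (fun s' =>
      ∃ θ A, IsSolution n m own D a b θ A ∧ ∀ c < m, s'.tab 1 c 0 = A c) := by
  obtain ⟨Θ, hΘ, hex⟩ := not_forall_exhausted hn hm ha hab hL hfin
  refine Ends.seq (P := fun s' => HoldsLabels n m v a b m own D s' ∧ s'.reg 5 = 0 ∧ s'.reg 12 = 0)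
    ((Ends.flat (by simp [Flat]) ⟨(h.setReg (by omega)).setReg (by omega),
      by simp [exec, MemState.setReg, Expr.eval], by simp [exec, MemState.setReg, Expr.eval]⟩).mono
        (show _ ≤ 4 by decide) fun _ => id) ?_
  rintro s₁ ⟨h1, h15, h112⟩
  refine (Ends.while (T := tryThresholdTime w + 4) (k := Θ + 1) (fun k s' =>
    HoldsLabels n m v a b m own D s' ∧
      (s'.reg 12 = 1 ∧ (∃ θ A, IsSolution n m own D a b θ A ∧ ∀ c < m, s'.tab 1 c 0 = A c) ∨
        s'.reg 12 = 0 ∧ ∃ θ : ℕ, s'.reg 5 = θ ∧ (∀ θ' < θ, Exhausted n m own D a b θ') ∧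
          k + θ = Θ + 1)) ?_ ⟨h1, Or.inr ⟨h112, 0, h15, by simp, rfl⟩⟩).mono ?_ ?_
  · rintro k s₂ ⟨h2, hst⟩ hc
    have h212 : s₂.reg 12 = 0 := by simpa [Cond.holds, Expr.eval] using hc
    obtain ⟨-, θ, h25, hθ, hk⟩ := hst.resolve_left fun hcon => by simp [hcon.1] at h212
    have hθΘ : θ ≤ Θ := by
      by_contra! hcon
      exact hex (hθ Θ hcon)
    refine Ends.seq (ends_tryThreshold hn ha hab hnw hmw h2 h25 h212) ?_
    rintro s₃ ⟨h3, h35, hst⟩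
    refine ⟨_, _, .assign _ _ _, le_rfl, k - 1, by omega, h3.setReg (by omega), ?_⟩
    rcases hst with ⟨h312, A, hA, hA'⟩ | ⟨h312, hexh⟩
    · exact Or.inl ⟨by simpa [MemState.setReg] using h312, θ, A, hA, hA'⟩
    · refine Or.inr ⟨by simpa [MemState.setReg] using h312, θ + 1,
        by simp [MemState.setReg, Expr.eval, h35], fun θ' hθ' => ?_, by omega⟩
      rcases Nat.lt_succ_iff_lt_or_eq.1 hθ' with hθ' | rfl
      · exact hθ θ' hθ'
      · exact hexh
  · have hΘw : Θ + 1 + 1 ≤ w ^ 2 + 4 := by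
      have : (n + 1) * m ≤ w * w := Nat.mul_le_mul hnw hmw.le
      rw [sq]
      omega
    simp only [Cond.cost, Expr.cost]
    exact Nat.mul_le_mul hΘw (by omega)
  · rintro s' ⟨k, ⟨-, hst⟩, hc⟩
    rcases hst with hst | hst
    · exact hst.2
    · simp [Cond.holds, Expr.eval, hst.1] at hc

end Thresholds

/-! ### The program -/

section Main

/-- The program that computes a DEF-`(n - 1)` and Pareto-optimal allocation. Without chores there is
nothing to do. -/
def choreProgram : Prog :=
  .ite (.lt (.const 0) (.var 1))
    (.seq computeCosts (.seq initOwners (.seq balanceLabels searchThreshold))) .skip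

def choreProgramTime {R : Type*} [Semiring R] (w : R) : R :=
  4 + (computeCostsTime w + (initOwnersTime w + (balanceLabelsTime w + searchThresholdTime w)))

theorem choreProgramTime_mono {w w' : ℕ} (h : w ≤ w') :
    choreProgramTime w ≤ choreProgramTime w' := by
  simp only [choreProgramTime, computeCostsTime, initOwnersTime, balanceLabelsTime, roundTime,
    moveStepTime, searchThresholdTime, tryThresholdTime, initLoadsTime, giveHardTime, giveTime,
    transfersTime, transferStepTime]
  gcongr

theorem eval_choreProgramTime (k : ℕ) :
    (choreProgramTime (Polynomial.X + 1 : Polynomial ℕ)).eval k = choreProgramTime (k + 1) := by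
  simp [choreProgramTime, computeCostsTime, initOwnersTime, balanceLabelsTime, roundTime,
    moveStepTime, searchThresholdTime, tryThresholdTime, initLoadsTime, giveHardTime, giveTime,
    transfersTime, transferStepTime]

variable {n m : ℕ}

theorem load_intCast {own D : ℕ → ℕ} {a b : ℤ} {θ : ℕ} {A : ℕ → ℕ} (i : ℕ) :
    load n m own D (a : ℝ) (b : ℝ) θ A i = (load n m own D a b θ A i : ℤ) := by
  rw [load, load, Int.cast_sum]
  refine sum_congr rfl fun c _ => ?_
  rw [price, price]
  split_ifs <;> simp

/-- Solutions with integer costs are solutions with real costs. -/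
theorem IsSolution.intCast {own D : ℕ → ℕ} {a b : ℤ} {θ : ℕ} {A : ℕ → ℕ}
    (h : IsSolution n m own D a b θ A) : IsSolution n m own D (a : ℝ) (b : ℝ) θ A where
  cheap := h.cheap
  kept := h.kept
  unassigned := h.unassigned
  bal_upper i hi hex j hj := by
    rw [load_intCast, load_intCast]
    exact_mod_cast h.bal_upper i hi hex j hj
  bal_lower k hk hex l hl := by
    rw [load_intCast, load_intCast]
    exact_mod_cast h.bal_lower k hk hex l hl
  total := h.total
  gap := h.gap
  priced := h.priced
  balanced p hp q hq := by
    rw [load_intCast, load_intCast]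
    exact_mod_cast h.balanced p hp q hq

/-- The program outputs a DEF-`(n - 1)` and Pareto-optimal allocation in time. -/
theorem ends_choreProgram (v : Fin n → Fin m → ℤ) (hn : 0 < n)
    (hv : IsBivalued (fun i c => (v i c : ℝ))) :
    Ends choreProgram (inputState v) (choreProgramTime (n + m + 1)) (fun s =>
      ∃ A : Fin m → Fin n, OutputsAllocation s A ∧ IsDEF (fun i c => (v i c : ℝ)) A (n - 1) ∧
        IsParetoOptimal (fun i c => (v i c : ℝ)) A) := by
  have hr0 : (inputState v).reg 0 = n := rfl
  have hr1 : (inputState v).reg 1 = m := rfl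
  refine (Ends.ite (T := computeCostsTime (n + m + 1) + (initOwnersTime (n + m + 1) +
    (balanceLabelsTime (n + m + 1) + searchThresholdTime (n + m + 1)))) (fun hc => ?_)
    fun hc => ?_).mono (by simp only [choreProgramTime, Cond.cost, Expr.cost]; omega) fun _ => id
  swap
  · have hm : m = 0 := by simpa [Cond.holds, Expr.eval, hr1] using hc
    subst hm
    refine (Ends.flat (p := .skip) trivial ⟨Fin.elim0, fun c => c.elim0,
      isDEF_and_isParetoOptimal_of_isEmpty _ _⟩).mono ?_ fun _ => id
    simp only [flatCost, searchThresholdTime]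
    omega
  have hm : 0 < m := by simpa [Cond.holds, Expr.eval, hr1] using hc
  have hnw : n < n + m + 1 := by omega
  have hmw : m < n + m + 1 := by omega
  refine Ends.seq (ends_computeCosts hn hm hnw hmw hr0 hr1 rfl) ?_
  rintro s₁ ⟨ht, a, b, h1, he⟩
  have htab : ∀ (i : Fin n) (c : Fin m), (inputState v).tab 0 i c = v i c := fun i c => by
    simp [inputState]
  have hbound : ∀ (i : Fin n) (c : Fin m), a ≤ -v i c ∧ -v i c ≤ b := fun i c => by
    rw [← htab]
    exact he.bound i i.2 c c.2 trivial
  obtain ⟨i₁, c₁, hi₁⟩ : ∃ i c, a = -v i c := by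
    obtain ⟨i, hi, c, hc, h⟩ := he.min_mem
    exact ⟨⟨i, hi⟩, ⟨c, hc⟩, by rw [h, ← htab]⟩
  obtain ⟨i₂, c₂, hi₂⟩ : ∃ i c, b = -v i c := by
    obtain ⟨i, hi, c, hc, h⟩ := he.max_mem
    exact ⟨⟨i, hi⟩, ⟨c, hc⟩, by rw [h, ← htab]⟩
  have hab : a ≤ b := hi₂ ▸ (hbound i₂ c₂).1
  have ha : 0 < a := by
    obtain ⟨x, y, hxy, hy, hv⟩ := hv
    replace hv : ∀ i c, (v i c : ℝ) = x ∨ (v i c : ℝ) = y := hv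
    have : (v i₁ c₁ : ℝ) < 0 := by rcases hv i₁ c₁ with h | h <;> rw [h] <;> linarith
    have : v i₁ c₁ < 0 := by exact_mod_cast this
    omega
  have hval : ∀ i c, v i c = -a ∨ v i c = -b := by
    intro i c
    obtain ⟨x, y, hxy, hy, hv⟩ := hv
    replace hv : ∀ i c, (v i c : ℝ) = x ∨ (v i c : ℝ) = y := hv
    have h3 := hbound i c
    -- three values among two numbers: `v i c` is one of the extreme values, or these coincide
    have h4 : v i c = v i₁ c₁ ∨ v i c = v i₂ c₂ ∨ v i₁ c₁ = v i₂ c₂ := by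
      have heq : ∀ {z z' : ℤ} {r : ℝ}, (z : ℝ) = r → (z' : ℝ) = r → z = z' := fun h h' => by
        exact_mod_cast h.trans h'.symm
      rcases hv i c with h | h
      · rcases hv i₁ c₁ with h' | h'
        · exact Or.inl (heq h h')
        · exact Or.inr ((hv i₂ c₂).imp (heq h) (heq h'))
      · rcases hv i₁ c₁ with h' | h'
        · exact Or.inr ((hv i₂ c₂).symm.imp (heq h) (heq h'))
        · exact Or.inl (heq h h')
    omega
  refine Ends.seq (ends_initOwners hnw hmw h1 (fun i => by rw [ht]; simp [inputState])
    fun i => by rw [ht]; simp [inputState]) ?_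
  rintro s₂ ⟨own, h2, hL⟩
  refine Ends.seq (ends_balanceLabels hnw hmw h2 hL) ?_
  rintro s₃ ⟨own, D, h3, hL, hfin⟩
  refine (ends_searchThreshold hn hm ha hab hnw hmw h3 hL hfin).mono le_rfl ?_
  rintro s₄ ⟨θ, A, hA, hA'⟩
  refine ⟨fun c => ⟨A c, hA.total c c.2⟩, fun c => hA' c c.2,
    hA.intCast.isDEF_and_isParetoOptimal hn (by exact_mod_cast ha) (by exact_mod_cast hab) hL _
      (fun i c h => ?_) (fun i c h => ?_) _ fun c => rfl⟩
  · have : v i c = -a := by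
      rw [Easy, htab] at h
      omega
    simp [this]
  · have : v i c = -b := by
      rw [Easy, htab] at h
      have := hval i c
      omega
    simp [this]

end Main

end ChoreDivision

open ChoreDivision in
theorem mainTheorem6 :
    (∀ (n m : ℕ) (v : Fin n → Fin m → ℝ), 0 < n → IsBivalued v →
      ∃ A : Fin m → Fin n, IsDEF v A (n - 1) ∧ IsParetoOptimal v A) ∧
    (∃ (p : Prog) (P : Polynomial ℕ),
      ∀ (n m : ℕ) (v : Fin n → Fin m → ℤ), 0 < n → IsBivalued (fun i c => (v i c : ℝ)) →
        ∃ (t : ℕ) (s : MemState) (A : Fin m → Fin n),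
          Runs p (inputState v) t s ∧ t ≤ P.eval (inputSize v) ∧ OutputsAllocation s A ∧
            IsDEF (fun i c => (v i c : ℝ)) A (n - 1) ∧
            IsParetoOptimal (fun i c => (v i c : ℝ)) A) := by
  refine ⟨fun n m v hn hv => exists_isDEF_and_isParetoOptimal v hn hv, choreProgram,
    choreProgramTime (Polynomial.X + 1), fun n m v hn hv => ?_⟩
  obtain ⟨t, s, hrun, ht, A, hA⟩ := ends_choreProgram v hn hv
  refine ⟨t, s, A, hrun, ht.trans ?_, hA⟩
  rw [eval_choreProgramTime]
  refine choreProgramTime_mono ?_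
  rw [inputSize]
  omega
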